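/- For an integer $m\ge 0$ write $(a;q)_m=\prod_{j=0}^{m-1}(1-aq^j)$, and write $(a;q)_\infty=\prod_{j=0}^{\infty}(1-aq^j)$ and $(a,b,c;q)_\infty=(a;q)_\infty(b;q)_\infty(c;q)_\infty$. Then, for every complex number $q$ with $|q|<1$, $$\sum_{n,r\ge 0}\frac{q^{2n^2+3r^2+4nr}}{(-q;q)_{2n+2r}\,(q;q^2)_r\,(q;q)_r\,(q^2;q^2)_n}=\frac{(q^{14},q^{16},q^{30};q^{30})_\infty}{(q^2;q^2)_\infty}$$ and $$\sum_{n,r\ge 0}\frac{q^{2n^2+3r^2+4nr+4n+6r}}{(-q;q)_{2n+2r+2}\,(q;q^2)_{r+1}\,(q;q)_r\,(q^2;q^2)_n}=\frac{(q^{2},q^{28},q^{30};q^{30})_\infty}{(q^2;q^2)_\infty},$$ both double series being absolutely convergent. Both identities also hold as identities of formal power series in $q$ with integer coefficients. -/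

import Mathlib

open scoped PowerSeries.WithPiTopology

/-- The finite rising `q`-factorial `(a;q)_m = ∏_{j=0}^{m-1} (1 - a q^j)`. -/
def qPoch {R : Type*} [CommRing R] (a q : R) (m : ℕ) : R :=
  ∏ j ∈ Finset.range m, (1 - a * q ^ j)

/-- The infinite rising `q`-factorial `(a;q)_∞ = ∏_{j=0}^∞ (1 - a q^j)`.
The two `multipliable` lemmas below show that the product converges in the cases
in which it is used. -/
noncomputable def qPochInf {R : Type*} [CommRing R] [TopologicalSpace R] (a q : R) : R :=
  ∏' j : ℕ, (1 - a * q ^ j)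

/-- The abbreviation `(a, b, c; q)_∞ = (a;q)_∞ (b;q)_∞ (c;q)_∞`. -/
noncomputable def qPochInf₃ {R : Type*} [CommRing R] [TopologicalSpace R] (a b c q : R) : R :=
  qPochInf a q * qPochInf b q * qPochInf c q

theorem multipliable_qPochInf_complex (a q : ℂ) (hq : ‖q‖ < 1) :
    Multipliable fun j : ℕ => (1 - a * q ^ j) := by
  have h : Summable fun j : ℕ => ‖-(a * q ^ j)‖ := by
    simp only [norm_neg, norm_mul, norm_pow]
    exact (summable_geometric_of_lt_one (norm_nonneg q) hq).mul_left _
  simpa only [sub_eq_add_neg] using multipliable_one_add_of_summable h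

theorem multipliable_qPochInf_powerSeries (a : PowerSeries ℤ) {k : ℕ} (hk : 0 < k) :
    Multipliable fun j : ℕ => (1 - a * ((PowerSeries.X : PowerSeries ℤ) ^ k) ^ j) := by
  simp only [sub_eq_add_neg]
  apply PowerSeries.WithPiTopology.multipliable_one_add_of_tendsto_order_atTop_nhds_top
  rw [ENat.tendsto_nhds_top_iff_natCast_lt]
  intro n
  filter_upwards [Filter.eventually_gt_atTop n] with j hj
  have h1 : ((k * j : ℕ) : ℕ∞) ≤ PowerSeries.order
      (-(a * ((PowerSeries.X : PowerSeries ℤ) ^ k) ^ j)) := by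
    apply PowerSeries.le_order
    intro i hi
    rw [← pow_mul, map_neg, PowerSeries.coeff_mul_X_pow', if_neg, neg_zero]
    have : i < k * j := by exact_mod_cast hi
    omega
  refine lt_of_lt_of_le ?_ h1
  exact_mod_cast lt_of_lt_of_le hj (Nat.le_mul_of_pos_left j hk)

open Filter Topology

/-! The proof is a Bailey chain argument. Write (q)_m for (q;q)_m, with 1/(q)_m = 0 for m < 0. Call
β_r = ∑_k c_k / ((q)_{r-e(k)} (q)_{r+e(k)}) the bilateral sum of the coefficients c at the indices
e(k).

The input is two such evaluations with c_k = (-1)^k q^(3k²+k): for e(k) = 2k, β_r = 1/((q;q)_r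
(q;q²)_r), and for e(k) = 2k+1, β_r = (1 - q^r)/((q;q)_r (q;q²)_r). Both follow from q-Pascal
recurrences (`bilateralSum_theta_even_mul`, `bilateralSum_theta_odd_mul`).

Two summation kernels, both cases of one q-Chu–Vandermonde sum (`qVandermonde`), then act on c. The
change of base q → q² multiplies c_k by q^(e(k)²), and the Bailey lemma in base q² multiplies it by
q^(2e(k)²). Together they turn 3k²+k into 15k²+k or, after removing a constant factor q³, into
15k²+13k (`sum_sum_mul_bilateralSum`).

As the outer index tends to infinity, the double sum of β becomes a theta series over (q²;q²)_∞
(`hasSum_doubleTerm`), and the Jacobi triple product (`tsum_thetaTerm`) gives the modulus 30. The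
triple product itself is the limit of a finite form proved by the same Pascal recurrences.

The analysis uses only a complete normed domain of characteristic zero with ‖q‖ < 1. It therefore
covers both ℂ and ℤ⟦X⟧ with its X-adic norm; in the latter case the result is carried to the
coefficientwise topology along the identity map. -/

/-- The power `q ^ x` for an integer `x ≥ 0` (and `1` for `x < 0`). -/
def powInt {R : Type*} [CommRing R] (q : R) (x : ℤ) : R := q ^ x.toNat

/-- The inverse `1 / (q;q)_m` for an integer `m ≥ 0`, extended by `0` to negative `m`. -/
noncomputable def qFactInv {R : Type*} [CommRing R] (q : R) (m : ℤ) : R :=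
  if 0 ≤ m then Ring.inverse (qPoch q q m.toNat) else 0

/-! ### Inverse q-factorials at integer indices and q-Chu–Vandermonde -/

section Algebra

variable {R : Type*} [CommRing R] {q : R}

theorem qPoch_zero (a q : R) : qPoch a q 0 = 1 := by simp [qPoch]

theorem qPoch_succ (a q : R) (n : ℕ) : qPoch a q (n + 1) = qPoch a q n * (1 - a * q ^ n) :=
  Finset.prod_range_succ _ _

theorem qPoch_add (a q : R) (m n : ℕ) :
    qPoch a q (m + n) = qPoch a q m * qPoch (a * q ^ m) q n := by
  simp [qPoch, Finset.prod_range_add, pow_add, mul_assoc]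

theorem isUnit_qPoch_self (hq : ∀ n : ℕ, IsUnit (1 - q ^ (n + 1))) (n : ℕ) :
    IsUnit (qPoch q q n) := by
  induction n with
  | zero => simp [qPoch_zero]
  | succ n ih => rw [qPoch_succ, ← pow_succ']; exact ih.mul (hq n)

theorem powInt_natCast (q : R) (n : ℕ) : powInt q n = q ^ n := by simp [powInt]

theorem powInt_zero (q : R) : powInt q 0 = 1 := by simp [powInt]

theorem powInt_add (q : R) {x y : ℤ} (hx : 0 ≤ x) (hy : 0 ≤ y) :
    powInt q (x + y) = powInt q x * powInt q y := by
  rw [powInt, powInt, powInt, Int.toNat_add hx hy, pow_add]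

theorem powInt_pow (q : R) (e : ℕ) (x : ℤ) : powInt (q ^ e) x = powInt q (e * x) := by
  rw [powInt, powInt, ← pow_mul]
  congr 1
  rcases le_or_gt 0 x with h | h
  · lift x to ℕ using h
    norm_cast
  · rw [Int.toNat_of_nonpos h.le, Int.toNat_of_nonpos]
    · simp
    · exact mul_nonpos_of_nonneg_of_nonpos (by positivity) h.le

theorem qFactInv_of_neg (q : R) {m : ℤ} (h : m < 0) : qFactInv q m = 0 := by
  simp [qFactInv, h]

theorem qFactInv_natCast (q : R) (m : ℕ) : qFactInv q m = Ring.inverse (qPoch q q m) := by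
  simp [qFactInv]

theorem qFactInv_zero (q : R) : qFactInv q 0 = 1 := by
  simp [qFactInv, qPoch_zero]

theorem qFactInv_mul_qPoch (hq : ∀ n : ℕ, IsUnit (1 - q ^ (n + 1))) (m : ℕ) :
    qFactInv q m * qPoch q q m = 1 := by
  rw [qFactInv_natCast, Ring.inverse_mul_cancel _ (isUnit_qPoch_self hq m)]

/-- The zero convention at negative indices keeps the recurrence valid for every integer: at `m = 0`
the factor 1 - q^0 vanishes. -/
theorem qFactInv_sub_one (hq : ∀ n : ℕ, IsUnit (1 - q ^ (n + 1))) (m : ℤ) :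
    qFactInv q (m - 1) = (1 - powInt q m) * qFactInv q m := by
  rcases lt_trichotomy m 0 with h | h | h
  · rw [qFactInv_of_neg q h, qFactInv_of_neg q (by omega), mul_zero]
  · subst h
    rw [qFactInv_of_neg q (by omega), powInt_zero, sub_self, zero_mul]
  · obtain ⟨n, rfl⟩ : ∃ n : ℕ, m = (n + 1 : ℕ) := ⟨(m - 1).toNat, by omega⟩
    have h1 : ((n + 1 : ℕ) : ℤ) - 1 = n := by push_cast; ring
    rw [h1, powInt_natCast]
    apply (isUnit_qPoch_self hq n).mul_right_cancel
    have h2 := qFactInv_mul_qPoch hq (n + 1)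
    rw [qPoch_succ] at h2
    rw [qFactInv_mul_qPoch hq, pow_succ']
    linear_combination -h2

theorem qFactInv_natCast_succ (hq : ∀ n : ℕ, IsUnit (1 - q ^ (n + 1))) (m : ℕ) :
    qFactInv q m = (1 - q ^ (m + 1)) * qFactInv q ((m + 1 : ℕ) : ℤ) := by
  rw [← powInt_natCast, ← qFactInv_sub_one hq]
  simp

/-- The `q`-Pascal rule. -/
theorem qFactInv_pascal (hq : ∀ n : ℕ, IsUnit (1 - q ^ (n + 1))) (M N : ℤ) :
    (1 - powInt q (M + N)) * (qFactInv q M * qFactInv q N) =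
      qFactInv q M * qFactInv q (N - 1) + powInt q N * (qFactInv q (M - 1) * qFactInv q N) := by
  rw [qFactInv_sub_one hq M, qFactInv_sub_one hq N]
  rcases lt_or_ge M 0 with hM | hM
  · simp [qFactInv_of_neg q hM]
  rcases lt_or_ge N 0 with hN | hN
  · simp [qFactInv_of_neg q hN]
  rw [powInt_add q hM hN]
  ring

/-- The `q`-Chu–Vandermonde sum in polynomial form. -/
theorem qVandermonde (hq : ∀ n : ℕ, IsUnit (1 - q ^ (n + 1))) (y : R) (m : ℕ) (c : R) :
    ∑ s ∈ Finset.range (m + 1), qFactInv q s * qFactInv q (m - s) *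
        ((∏ i ∈ Finset.range s, c * q ^ i * (q ^ i - y)) * ∏ i ∈ Finset.Ico s m, (1 - c * q ^ i)) =
      qFactInv q m * ∏ i ∈ Finset.range m, (1 - c * y * q ^ i) := by
  induction m generalizing c with
  | zero => simp [qFactInv_zero]
  | succ m ih =>
    apply (hq m).mul_left_cancel
    rw [← mul_assoc, ← qFactInv_natCast_succ hq m, Finset.prod_range_succ', Finset.mul_sum]
    have hR : (∏ k ∈ Finset.range m, (1 - c * y * q ^ (k + 1))) =
        ∏ k ∈ Finset.range m, (1 - c * q * y * q ^ k) :=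
      Finset.prod_congr rfl fun k _ => by ring
    rw [hR, pow_zero, mul_one, ← mul_assoc, ← ih (c * q), Finset.sum_mul]
    set P : ℕ → R := fun s => ∏ i ∈ Finset.range s, c * q ^ i * (q ^ i - y) with hP
    set T : ℕ → R := fun s => ∏ i ∈ Finset.Ico s (m + 1), (1 - c * q ^ i) with hT
    -- The q-Pascal rule splits each summand in two. After the first half is shifted by one, the
    -- halves recombine at each s through c q^s (q^s - y) + q^s (1 - c q^s) = q^s (1 - c y), which
    -- is (1 - c y) times the summand for `m` with c replaced by c q.
    have hsplit : ∀ s ∈ Finset.range (m + 1 + 1),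
        (1 - q ^ (m + 1)) * (qFactInv q s * qFactInv q (((m + 1 : ℕ) : ℤ) - s) * (P s * T s)) =
          qFactInv q ((s : ℤ) - 1) * qFactInv q ((m : ℤ) + 1 - s) * (P s * T s) +
          q ^ s * (qFactInv q s * qFactInv q ((m : ℤ) - s)) * (P s * T s) := by
      intro s _
      have h := qFactInv_pascal hq ((m : ℤ) + 1 - s) s
      have e1 : (m : ℤ) + 1 - s + s = ((m + 1 : ℕ) : ℤ) := by push_cast; ring
      have e2 : (m : ℤ) + 1 - s - 1 = m - s := by ring
      rw [e1, e2, powInt_natCast, powInt_natCast] at h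
      push_cast
      linear_combination (P s * T s) * h
    rw [Finset.sum_congr rfl hsplit, Finset.sum_add_distrib, Finset.sum_range_succ',
      Finset.sum_range_succ (n := m + 1)]
    have z1 : qFactInv q (((0 : ℕ) : ℤ) - 1) = 0 := qFactInv_of_neg q (by simp)
    have z2 : qFactInv q ((m : ℤ) - (m + 1 : ℕ)) = 0 := qFactInv_of_neg q (by push_cast; omega)
    rw [z1, z2]
    simp only [zero_mul, mul_zero, add_zero]
    rw [← Finset.sum_add_distrib]
    refine Finset.sum_congr rfl fun s hs => ?_
    have hs' : s < m + 1 := Finset.mem_range.mp hs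
    have e3 : ((s + 1 : ℕ) : ℤ) - 1 = s := by push_cast; ring
    have e4 : (m : ℤ) + 1 - (s + 1 : ℕ) = m - s := by push_cast; ring
    have hP1 : P (s + 1) = P s * (c * q ^ s * (q ^ s - y)) := Finset.prod_range_succ _ _
    have hP2 : ∏ i ∈ Finset.range s, c * q * q ^ i * (q ^ i - y) = q ^ s * P s := by
      rw [hP]
      simp only
      rw [← Finset.card_range s, ← Finset.prod_const, Finset.card_range, ← Finset.prod_mul_distrib]
      exact Finset.prod_congr rfl fun k _ => by ring
    have hT1 : T s = (1 - c * q ^ s) * T (s + 1) := Finset.prod_eq_prod_Ico_succ_bot hs' _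
    have hT2 : ∏ i ∈ Finset.Ico s m, (1 - c * q * q ^ i) = T (s + 1) := by
      rw [hT]
      simp only
      rw [← Finset.prod_Ico_add' (fun i => 1 - c * q ^ i) s m 1]
      exact Finset.prod_congr rfl fun k _ => by ring
    rw [e3, e4, hP1, hP2, hT1, hT2]
    ring

end Algebra

/-! ### The Bailey kernel and the change-of-base kernel -/

section Kernel

variable {R : Type*} [CommRing R] {q : R}

theorem qFactInv_add_eq_prod (hq : ∀ n : ℕ, IsUnit (1 - q ^ (n + 1))) (J : ℕ) {s m : ℕ}
    (h : s ≤ m) :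
    qFactInv q ((J : ℤ) + s) =
      qFactInv q ((J : ℤ) + m) * ∏ i ∈ Finset.Ico s m, (1 - q ^ (J + 1) * q ^ i) := by
  induction m, h using Nat.le_induction with
  | base => simp
  | succ m h ih =>
    rw [Finset.prod_Ico_succ_top h, ih]
    have h1 := qFactInv_natCast_succ hq (J + m)
    push_cast at h1 ⊢
    rw [h1, add_assoc (J : ℤ)]
    ring

/-- This is `qVandermonde` at c = q^(J+1): its tail product turns 1/(q)_{J+m} into 1/(q)_{J+s}. The
parameter `y` stays free; y = 0 gives the Bailey kernel and y = -q^m the change of base. -/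
theorem sum_qFactInv_mul (hq : ∀ n : ℕ, IsUnit (1 - q ^ (n + 1))) (y : R) (J m : ℕ) :
    ∑ s ∈ Finset.range (m + 1), qFactInv q s * qFactInv q (m - s) * qFactInv q ((J : ℤ) + s) *
        ∏ i ∈ Finset.range s, q ^ (J + 1) * q ^ i * (q ^ i - y) =
      qFactInv q m * qFactInv q ((J : ℤ) + m) *
        ∏ i ∈ Finset.range m, (1 - q ^ (J + 1) * y * q ^ i) := by
  have h := qVandermonde hq y m (q ^ (J + 1))
  rw [mul_assoc, mul_left_comm, ← h, Finset.mul_sum]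
  refine Finset.sum_congr rfl fun s hs => ?_
  rw [qFactInv_add_eq_prod hq J (Finset.mem_range_succ_iff.mp hs)]
  ring

theorem sum_pow_mul_qFactInv (hq : ∀ n : ℕ, IsUnit (1 - q ^ (n + 1))) (J m : ℕ) :
    ∑ s ∈ Finset.range (m + 1), q ^ (s ^ 2 + J * s) *
        (qFactInv q (m - s) * (qFactInv q s * qFactInv q ((J : ℤ) + s))) =
      qFactInv q m * qFactInv q ((J : ℤ) + m) := by
  have h := sum_qFactInv_mul hq 0 J m
  simp only [mul_zero, zero_mul, sub_zero, Finset.prod_const_one, mul_one] at h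
  rw [← h]
  refine Finset.sum_congr rfl fun s _ => ?_
  have hp : ∀ s, ∏ i ∈ Finset.range s, q ^ (J + 1) * q ^ i * q ^ i = q ^ (s ^ 2 + J * s) := by
    intro s
    induction s with
    | zero => simp
    | succ s ih =>
      rw [Finset.prod_range_succ, ih]
      ring
  rw [hp]
  ring

theorem isUnit_one_sub_pow_pow (hq : ∀ n : ℕ, IsUnit (1 - q ^ (n + 1))) {e : ℕ} (he : 0 < e)
    (n : ℕ) : IsUnit (1 - (q ^ e) ^ (n + 1)) := by
  obtain ⟨k, hk⟩ : ∃ k, e * (n + 1) = k + 1 := ⟨e * (n + 1) - 1, by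
    have : 0 < e * (n + 1) := by positivity
    omega⟩
  rw [← pow_mul, hk]
  exact hq k

theorem isUnit_one_add_pow (hq : ∀ n : ℕ, IsUnit (1 - q ^ (n + 1))) (n : ℕ) :
    IsUnit (1 + q ^ (n + 1)) := by
  have h := isUnit_one_sub_pow_pow hq two_pos n
  have h2 : 1 - (q ^ 2) ^ (n + 1) = (1 - q ^ (n + 1)) * (1 + q ^ (n + 1)) := by ring
  rw [h2] at h
  exact isUnit_of_mul_isUnit_right h

theorem isUnit_qPoch_neg (hq : ∀ n : ℕ, IsUnit (1 - q ^ (n + 1))) (n : ℕ) :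
    IsUnit (qPoch (-q) q n) := by
  induction n with
  | zero => simp [qPoch_zero]
  | succ n ih =>
    rw [qPoch_succ, neg_mul, sub_neg_eq_add, ← pow_succ']
    exact ih.mul (isUnit_one_add_pow hq n)

theorem qPoch_sq (q : R) (n : ℕ) : qPoch (q ^ 2) (q ^ 2) n = qPoch q q n * qPoch (-q) q n := by
  rw [qPoch, qPoch, qPoch, ← Finset.prod_mul_distrib]
  exact Finset.prod_congr rfl fun k _ => by ring

theorem qFactInv_sq_mul (hq : ∀ n : ℕ, IsUnit (1 - q ^ (n + 1))) (n : ℕ) :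
    qFactInv (q ^ 2) n * qPoch (-q) q n = qFactInv q n := by
  have h1 := qFactInv_mul_qPoch hq n
  have h2 := qFactInv_mul_qPoch (isUnit_one_sub_pow_pow hq two_pos) n
  rw [qPoch_sq] at h2
  linear_combination qFactInv q n * h2 - qFactInv (q ^ 2) n * qPoch (-q) q n * h1

/-- Since q^i + q^m = q^i (1 + q^(m-i)), the factors 1 + q^(m-i) telescope to (-q;q)_m /
(-q;q)_{m-s}. -/
theorem prod_mul_qPoch_neg (q : R) (J m : ℕ) {s : ℕ} (hs : s ≤ m) :
    (∏ i ∈ Finset.range s, q ^ (J + 1) * q ^ i * (q ^ i - -q ^ m)) * qPoch (-q) q (m - s) =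
      q ^ (s ^ 2 + J * s) * qPoch (-q) q m := by
  induction s with
  | zero => simp
  | succ s ih =>
    rw [Finset.prod_range_succ]
    obtain ⟨t, rfl⟩ : ∃ t, m = s + 1 + t := ⟨m - (s + 1), by omega⟩
    have h := ih (by omega)
    have e1 : s + 1 + t - s = t + 1 := by omega
    have e2 : s + 1 + t - (s + 1) = t := by omega
    rw [e1, qPoch_succ] at h
    rw [e2]
    have e3 : q ^ ((s + 1) ^ 2 + J * (s + 1)) = q ^ (s ^ 2 + J * s) * q ^ (J + 1 + 2 * s) := by
      rw [← pow_add]; congr 1; ring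
    rw [e3, mul_right_comm (q ^ (s ^ 2 + J * s)), ← h]
    ring

/-- Taking y = -q^m produces factors (-q;q), and (q²;q²)_n = (q;q)_n (-q;q)_n converts them into
inverse factorials in base q². The right-hand product (-q^(J+m+1);q)_m extends (-q;q)_{J+m} to
(-q;q)_{J+2m}. -/
theorem sum_pow_mul_qFactInv_sq (hq : ∀ n : ℕ, IsUnit (1 - q ^ (n + 1))) (J m : ℕ) :
    ∑ s ∈ Finset.range (m + 1), q ^ (s ^ 2 + J * s) *
        (qFactInv (q ^ 2) (m - s) * (qFactInv q s * qFactInv q ((J : ℤ) + s))) =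
      qPoch (-q) q (J + 2 * m) * (qFactInv (q ^ 2) m * qFactInv (q ^ 2) ((J : ℤ) + m)) := by
  apply (isUnit_qPoch_neg hq m).mul_left_cancel
  have h := sum_qFactInv_mul hq (-q ^ m) J m
  have hr : ∏ i ∈ Finset.range m, (1 - q ^ (J + 1) * -q ^ m * q ^ i) =
      qPoch (-q * q ^ (J + m)) q m :=
    Finset.prod_congr rfl fun k _ => by ring
  have e1 : J + 2 * m = (J + m) + m := by ring
  have h1 := qFactInv_sq_mul hq m
  have h2 := qFactInv_sq_mul hq (J + m)
  push_cast at h2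
  rw [hr, ← h1, ← h2] at h
  rw [e1, qPoch_add]
  refine Eq.trans ?_ (h.trans (by ring))
  rw [Finset.mul_sum]
  refine Finset.sum_congr rfl fun s hs => ?_
  have hs' := Finset.mem_range_succ_iff.mp hs
  have h3 := qFactInv_sq_mul hq (m - s)
  rw [Nat.cast_sub hs'] at h3
  rw [← h3]
  linear_combination -(qFactInv q s * qFactInv (q ^ 2) (m - s) * qFactInv q (J + s)) *
    prod_mul_qPoch_neg q J m hs'

/-- For 0 ≤ j ≤ n, substitute J = 2j, m = n - j, s = r - j, so that s² + Js = r² - j². Terms with r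
< j vanish, and negative j follows from the symmetry j ↔ -j. -/
theorem sum_kernel_of_shift {v w f : ℤ → R} (hw : ∀ m < 0, w m = 0)
    {X : ℕ → R}
    (h : ∀ J m : ℕ, ∑ s ∈ Finset.range (m + 1), q ^ (s ^ 2 + J * s) *
        (v (m - s) * (w s * w ((J : ℤ) + s))) = X (J + 2 * m) * (f m * f ((J : ℤ) + m)))
    (hf : ∀ m < 0, f m = 0) (n : ℕ) (j : ℤ) :
    ∑ r ∈ Finset.range (n + 1), powInt q ((r : ℤ) ^ 2 - j ^ 2) *
        (v (n - r) * (w (r - j) * w (r + j))) =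
      X (2 * n) * (f (n - j) * f (n + j)) := by
  have key : ∀ j : ℕ, ∑ r ∈ Finset.range (n + 1), powInt q ((r : ℤ) ^ 2 - (j : ℤ) ^ 2) *
        (v (n - r) * (w (r - j) * w (r + j))) =
      X (2 * n) * (f (n - j) * f (n + j)) := by
    intro j
    rcases lt_or_ge n j with hj | hj
    · rw [hf (n - j) (by omega), zero_mul, mul_zero]
      refine Finset.sum_eq_zero fun r hr => ?_
      have := Finset.mem_range_succ_iff.mp hr
      rw [hw (r - j) (by omega)]
      ring
    · obtain ⟨m, rfl⟩ := Nat.exists_eq_add_of_le hj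
      have e1 : 2 * (j + m) = 2 * j + 2 * m := by ring
      have e2 : ((j + m : ℕ) : ℤ) - j = m := by push_cast; ring
      have e3 : ((j + m : ℕ) : ℤ) + j = (2 * j : ℕ) + m := by push_cast; ring
      rw [add_assoc, Finset.sum_range_add, e1, e2, e3, ← h, Finset.sum_eq_zero, zero_add]
      · refine Finset.sum_congr rfl fun s _ => ?_
        have e4 : ((j + s : ℕ) : ℤ) ^ 2 - (j : ℤ) ^ 2 = ((s ^ 2 + 2 * j * s : ℕ) : ℤ) := by
          push_cast; ring
        have e5 : ((j + m : ℕ) : ℤ) - (j + s : ℕ) = m - s := by push_cast; ring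
        have e6 : ((j + s : ℕ) : ℤ) - j = s := by push_cast; ring
        have e7 : ((j + s : ℕ) : ℤ) + j = (2 * j : ℕ) + s := by push_cast; ring
        rw [e4, e5, e6, e7, powInt_natCast]
      · intro r hr
        have := Finset.mem_range.mp hr
        rw [hw (r - j) (by omega)]
        ring
  rcases Int.natAbs_eq j with hj | hj
  · rw [hj]
    exact key _
  · rw [hj]
    simp only [sub_neg_eq_add, ← sub_eq_add_neg, neg_sq]
    rw [mul_comm (f (n + _)), ← key]
    exact Finset.sum_congr rfl fun r _ => by ring

/-- The kernel of the Bailey lemma (both parameters sent to infinity). -/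
theorem sum_bailey_kernel (hq : ∀ n : ℕ, IsUnit (1 - q ^ (n + 1))) (n : ℕ) (j : ℤ) :
    ∑ r ∈ Finset.range (n + 1), powInt q ((r : ℤ) ^ 2 - j ^ 2) *
        (qFactInv q (n - r) * (qFactInv q (r - j) * qFactInv q (r + j))) =
      qFactInv q (n - j) * qFactInv q (n + j) := by
  have h := sum_kernel_of_shift (q := q) (X := fun _ => 1) (fun _ => qFactInv_of_neg q) (f := qFactInv q)
    (fun J m => by rw [one_mul, ← sum_pow_mul_qFactInv hq]) (fun _ => qFactInv_of_neg q) n j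
  rw [h, one_mul]

/-- The kernel of the change of base from `q` to `q ^ 2`. -/
theorem sum_change_of_base_kernel (hq : ∀ n : ℕ, IsUnit (1 - q ^ (n + 1))) (n : ℕ) (j : ℤ) :
    ∑ r ∈ Finset.range (n + 1), powInt q ((r : ℤ) ^ 2 - j ^ 2) *
        (qFactInv (q ^ 2) (n - r) * (qFactInv q (r - j) * qFactInv q (r + j))) =
      qPoch (-q) q (2 * n) * (qFactInv (q ^ 2) (n - j) * qFactInv (q ^ 2) (n + j)) :=
  sum_kernel_of_shift (fun _ => qFactInv_of_neg q)
    (sum_pow_mul_qFactInv_sq hq) (fun _ => qFactInv_of_neg _) n j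

end Kernel

/-! ### Bilateral sums, their Pascal recurrences and the finite triple product -/

/-- The bilateral sum `∑ c_k / ((q;q)_{A - e(k)} (q;q)_{B + e(k)})` over the integers `k`. -/
noncomputable def bilateralSum {R : Type*} [CommRing R] (q : R) (c : ℤ → R) (e : ℤ → ℤ)
    (A B : ℤ) : R :=
  ∑ᶠ k : ℤ, c k * (qFactInv q (A - e k) * qFactInv q (B + e k))

/-- The general term `(-1)^k q^(e k^2 + f k)` of a theta series. -/
def thetaTerm {R : Type*} [CommRing R] (q : R) (e f k : ℤ) : R :=
  ((Int.negOnePow k : ℤ) : R) * powInt q (e * k ^ 2 + f * k)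

section Bilateral

variable {R : Type*} [CommRing R] {q : R}

theorem finite_support_bilateral (q : R) (c : ℤ → R) {e : ℤ → ℤ} (he : e.Injective) (A B : ℤ) :
    (Function.support fun k => c k * (qFactInv q (A - e k) * qFactInv q (B + e k))).Finite := by
  refine ((Set.finite_Icc (-B) A).preimage he.injOn).subset fun k hk => ?_
  rw [Function.mem_support] at hk
  rw [Set.mem_preimage, Set.mem_Icc]
  by_contra h
  apply hk
  rcases lt_or_ge A (e k) with h1 | h1
  · rw [qFactInv_of_neg q (by omega)]
    ring
  · rw [qFactInv_of_neg q (m := B + e k) (by omega)]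
    ring

theorem bilateralSum_eq_mul [IsDomain R] (σ : ℤ ≃ ℤ) {c c' : ℤ → R} {e e' : ℤ → ℤ}
    {A B A' B' : ℤ} (x : R)
    (h : ∀ k, c (σ k) * (qFactInv q (A - e (σ k)) * qFactInv q (B + e (σ k))) =
      x * (c' k * (qFactInv q (A' - e' k) * qFactInv q (B' + e' k)))) :
    bilateralSum q c e A B = x * bilateralSum q c' e' A' B' := by
  rw [bilateralSum, bilateralSum, mul_finsum, ← finsum_comp_equiv σ]
  exact finsum_congr h

/-- Either `B` or `A` drops by one, and only the second sum acquires a weight. For theta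
coefficients that weight can be absorbed by reindexing k, giving a closed recurrence; the mirrored
rule puts the weight on the sum with `B` lowered. -/
theorem bilateralSum_pascal_left [IsDomain R] (hq : ∀ n : ℕ, IsUnit (1 - q ^ (n + 1)))
    (c : ℤ → R) {e : ℤ → ℤ} (he : e.Injective) (A B : ℤ) :
    (1 - powInt q (A + B)) * bilateralSum q c e A B =
      bilateralSum q c e A (B - 1) +
        bilateralSum q (fun k => c k * powInt q (B + e k)) e (A - 1) B := by
  rw [bilateralSum, bilateralSum, bilateralSum, mul_finsum, ← finsum_add_distrib
    (finite_support_bilateral q _ he _ _) (finite_support_bilateral q _ he _ _)]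
  refine finsum_congr fun k => ?_
  have h := qFactInv_pascal hq (A - e k) (B + e k)
  have e1 : A - e k + (B + e k) = A + B := by ring
  have e2 : A - e k - 1 = A - 1 - e k := by ring
  have e3 : B + e k - 1 = B - 1 + e k := by ring
  rw [e1, e2, e3] at h
  linear_combination c k * h

theorem bilateralSum_pascal_right [IsDomain R] (hq : ∀ n : ℕ, IsUnit (1 - q ^ (n + 1)))
    (c : ℤ → R) {e : ℤ → ℤ} (he : e.Injective) (A B : ℤ) :
    (1 - powInt q (A + B)) * bilateralSum q c e A B =
      bilateralSum q c e (A - 1) B +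
        bilateralSum q (fun k => c k * powInt q (A - e k)) e A (B - 1) := by
  rw [bilateralSum, bilateralSum, bilateralSum, mul_finsum, ← finsum_add_distrib
    (finite_support_bilateral q _ he _ _) (finite_support_bilateral q _ he _ _)]
  refine finsum_congr fun k => ?_
  have h := qFactInv_pascal hq (B + e k) (A - e k)
  have e1 : B + e k + (A - e k) = A + B := by ring
  have e2 : A - e k - 1 = A - 1 - e k := by ring
  have e3 : B + e k - 1 = B - 1 + e k := by ring
  rw [e1, e2, e3] at h
  linear_combination c k * h

theorem bilateralSum_zero_zero (q : R) (c : ℤ → R) {e : ℤ → ℤ} (he : e.Injective) {k : ℤ}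
    (hk : e k = 0) : bilateralSum q c e 0 0 = c k := by
  rw [bilateralSum, finsum_eq_single _ k]
  · simp [hk, qFactInv_zero]
  · intro i hi
    have h : e i ≠ 0 := fun h => hi (he (h.trans hk.symm))
    rcases lt_or_gt_of_ne h with h | h
    · rw [qFactInv_of_neg q (m := 0 + e i) (by omega)]
      ring
    · rw [qFactInv_of_neg q (by omega)]
      ring

theorem bilateralSum_theta_odd_zero (q : R) (c : ℤ → R) :
    bilateralSum q c (fun k => 2 * k + 1) 0 0 = 0 := by
  refine finsum_eq_zero_of_forall_eq_zero fun k => ?_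
  rcases lt_or_ge k 0 with h | h
  · rw [qFactInv_of_neg q (m := 0 + (2 * k + 1)) (by omega)]
    ring
  · rw [qFactInv_of_neg q (m := 0 - (2 * k + 1)) (by omega)]
    ring

theorem sq_mul_add_mul_nonneg {e f : ℤ} (hf : |f| ≤ e) (k : ℤ) : 0 ≤ e * k ^ 2 + f * k := by
  have h1 : |f * k| ≤ e * k ^ 2 := by
    rw [abs_mul]
    have h2 : |k| ≤ k ^ 2 := by rw [← sq_abs]; exact Int.le_self_sq _
    exact mul_le_mul hf h2 (abs_nonneg k) ((abs_nonneg f).trans hf)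
  linarith [neg_abs_le (f * k)]

/-- `powInt` truncates negative exponents, so exponent laws need signs. In the applications an
exponent that may be negative occurs beside an inverse factorial that then vanishes. -/
theorem powInt_add₃ (q : R) {x y z x' y' : ℤ} (hx : 0 ≤ x) (hy : 0 ≤ y) (hx' : 0 ≤ x')
    (hy' : 0 ≤ y') (hz : 0 ≤ z) (h : x + y = x' + y' + z) :
    powInt q x * powInt q y = powInt q x' * powInt q y' * powInt q z := by
  rw [← powInt_add q hx hy, ← powInt_add q hx' hy', ← powInt_add q (add_nonneg hx' hy') hz, h]

/-- The finite form of the Jacobi triple product. -/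
theorem bilateralSum_thetaTerm [IsDomain R] (hq : ∀ n : ℕ, IsUnit (1 - q ^ (n + 1)))
    {e f : ℕ} (he : 0 < e) (hf : f ≤ e) (L : ℕ) :
    bilateralSum (q ^ (2 * e)) (thetaTerm q e f) id L L =
      qFactInv (q ^ (2 * e)) (2 * L : ℕ) *
        (qPoch (q ^ (e + f)) (q ^ (2 * e)) L * qPoch (q ^ (e - f)) (q ^ (2 * e)) L) := by
  have hp := isUnit_one_sub_pow_pow hq (e := 2 * e) (by positivity)
  have hef : |(f : ℤ)| ≤ e := by rw [abs_of_nonneg (by positivity)]; exact_mod_cast hf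
  set p := q ^ (2 * e) with hpdef
  have hpp : ∀ x, powInt p x = powInt q (2 * e * x) := fun x => by
    rw [hpdef, powInt_pow]; push_cast; rfl
  induction L with
  | zero =>
    have := bilateralSum_zero_zero p (thetaTerm q e f) Function.injective_id (k := 0) rfl
    simp [this, thetaTerm, powInt_zero, qFactInv_zero, qPoch_zero]
  | succ L ih =>
    have h1 := bilateralSum_pascal_left hp (thetaTerm q e f) Function.injective_id L (L + 1)
    have h2 := bilateralSum_pascal_right hp (thetaTerm q e f) Function.injective_id (L + 1) (L + 1)
    have hb : powInt q (e - f) = q ^ (e - f) := by rw [← powInt_natCast, Nat.cast_sub hf]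
    have ha : powInt q (e + f) = q ^ (e + f) := by rw [← powInt_natCast, Nat.cast_add]
    have hL : powInt q (2 * e * L) = p ^ L := by rw [← hpp, powInt_natCast]
    -- The shift k → k - 1 gives the factor 1 - q^(e-f) p^L in passing from (L, L) to (L, L+1); the
    -- shift k → k + 1 below gives 1 - q^(e+f) p^L in passing to (L+1, L+1).
    have h3 : bilateralSum p (fun k => thetaTerm q e f k * powInt p ((L : ℤ) + 1 + id k)) id
        (L - 1) (L + 1) = -(q ^ (e - f) * p ^ L) * bilateralSum p (thetaTerm q e f) id L L := by
      refine bilateralSum_eq_mul (Equiv.addRight (-1)) _ fun k => ?_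
      simp only [Equiv.coe_addRight, id, thetaTerm, hpp]
      rw [show (L : ℤ) - 1 - (k + -1) = L - k by ring, show (L : ℤ) + 1 + (k + -1) = L + k by ring,
        ← sub_eq_add_neg, Int.negOnePow_sub, Int.negOnePow_one]
      rcases lt_or_ge ((L : ℤ) + k) 0 with h | h
      · simp [qFactInv_of_neg p h]
      have := powInt_add₃ q (sq_mul_add_mul_nonneg hef (k - 1))
        (by positivity : 0 ≤ 2 * (e : ℤ) * (L + k)) (by omega : 0 ≤ (e : ℤ) - f)
        (by positivity : 0 ≤ 2 * (e : ℤ) * L) (sq_mul_add_mul_nonneg hef k) (by ring)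
      rw [hb, hL] at this
      push_cast
      linear_combination -((Int.negOnePow k : ℤ) : R) * qFactInv p (L - k) *
        qFactInv p (L + k) * this
    have h4 : bilateralSum p (fun k => thetaTerm q e f k * powInt p ((L : ℤ) + 1 - id k)) id
        (L + 1) L = -(q ^ (e + f) * p ^ L) *
          bilateralSum p (thetaTerm q e f) id L (L + 1) := by
      refine bilateralSum_eq_mul (Equiv.addRight 1) _ fun k => ?_
      simp only [Equiv.coe_addRight, id, thetaTerm, hpp]
      rw [show (L : ℤ) + 1 - (k + 1) = L - k by ring, show (L : ℤ) + (k + 1) = L + 1 + k by ring,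
        Int.negOnePow_succ]
      rcases lt_or_ge ((L : ℤ) - k) 0 with h | h
      · simp [qFactInv_of_neg p h]
      have := powInt_add₃ q (sq_mul_add_mul_nonneg hef (k + 1))
        (by positivity : 0 ≤ 2 * (e : ℤ) * (L - k)) (by positivity : 0 ≤ (e : ℤ) + f)
        (by positivity : 0 ≤ 2 * (e : ℤ) * L) (sq_mul_add_mul_nonneg hef k) (by ring)
      rw [ha, hL] at this
      push_cast
      linear_combination -((Int.negOnePow k : ℤ) : R) * qFactInv p (L - k) *
        qFactInv p (L + 1 + k) * this
    have e1 : powInt p ((L : ℤ) + (L + 1)) = p ^ (2 * L + 1) := by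
      rw [← powInt_natCast]; congr 1; push_cast; ring
    have e2 : powInt p ((L : ℤ) + 1 + (L + 1)) = p ^ (2 * L + 1 + 1) := by
      rw [← powInt_natCast]; congr 1; push_cast; ring
    rw [add_sub_cancel_right, e1, h3] at h1
    rw [add_sub_cancel_right, e2, h4] at h2
    have w1 := qFactInv_natCast_succ hp (2 * L)
    have w2 := qFactInv_natCast_succ hp (2 * L + 1)
    rw [ih] at h1
    push_cast at h1 h2 w1 w2 ⊢
    rw [qPoch_succ, qPoch_succ]
    rw [show 2 * ((L : ℤ) + 1) = 2 * L + 1 + 1 by ring]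
    apply (hp (2 * L)).mul_left_cancel
    apply (hp (2 * L + 1)).mul_left_cancel
    rw [w2] at w1
    rw [w1] at h1
    linear_combination (1 - p ^ (2 * L + 1)) * h2 + (1 - q ^ (e + f) * p ^ L) * h1

end Bilateral

/-! ### The two Bailey pairs -/

section BaileyPair

variable {R : Type*} [CommRing R] [IsDomain R] {q : R}

theorem injective_two_mul_add (d : ℤ) : Function.Injective fun k : ℤ => 2 * k + d := by
  intro a b h
  simp only at h
  omega

/-- The reflection k → -1 - k fixes 3k² + 3k, swaps the two denominators and reverses the sign, so
the sum is its own negative. -/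
theorem bilateralSum_theta_odd_eq_zero [CharZero R] (q : R) (n : ℤ) :
    bilateralSum q (thetaTerm q 3 3) (fun k => 2 * k + 1) n n = 0 := by
  have h : bilateralSum q (thetaTerm q 3 3) (fun k => 2 * k + 1) n n =
      (-1) * bilateralSum q (thetaTerm q 3 3) (fun k => 2 * k + 1) n n := by
    refine bilateralSum_eq_mul (Equiv.subLeft (-1)) _ fun k => ?_
    simp only [Equiv.subLeft_apply, thetaTerm]
    rw [show n - (2 * (-1 - k) + 1) = n + (2 * k + 1) by ring,
      show n + (2 * (-1 - k) + 1) = n - (2 * k + 1) by ring,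
      show 3 * (-1 - k) ^ 2 + 3 * (-1 - k) = 3 * k ^ 2 + 3 * k by ring,
      Int.negOnePow_sub, Int.negOnePow_neg, Int.negOnePow_one]
    push_cast
    ring
  rw [neg_one_mul] at h
  exact self_eq_neg.mp h

/-- The weighted Pascal term is a multiple of the antisymmetric sum of
`bilateralSum_theta_odd_eq_zero`, hence zero. -/
theorem bilateralSum_theta_recurrence [CharZero R] (hq : ∀ n : ℕ, IsUnit (1 - q ^ (n + 1)))
    (n : ℕ) :
    (1 - q ^ (2 * n + 1)) * bilateralSum q (thetaTerm q 3 1) (fun k => 2 * k + 0) n (n + 1) =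
      bilateralSum q (thetaTerm q 3 1) (fun k => 2 * k + 0) n n := by
  have h := bilateralSum_pascal_left hq (thetaTerm q 3 1) (injective_two_mul_add 0) n (n + 1)
  have h2 : bilateralSum q (fun k => thetaTerm q 3 1 k * powInt q ((n : ℤ) + 1 + (2 * k + 0)))
      (fun k => 2 * k + 0) (n - 1) (n + 1) =
      q ^ (n + 1) * bilateralSum q (thetaTerm q 3 3) (fun k => 2 * k + 1) n n := by
    refine bilateralSum_eq_mul (Equiv.refl _) _ fun k => ?_
    simp only [Equiv.refl_apply, thetaTerm]
    rw [show (n : ℤ) - 1 - (2 * k + 0) = n - (2 * k + 1) by ring,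
      show (n : ℤ) + 1 + (2 * k + 0) = n + (2 * k + 1) by ring]
    rcases lt_or_ge ((n : ℤ) + (2 * k + 1)) 0 with hk | hk
    · simp only [qFactInv_of_neg q hk, mul_zero]
    have := powInt_add₃ q (sq_mul_add_mul_nonneg (by norm_num : |(1 : ℤ)| ≤ 3) k) hk
      le_rfl (by positivity : 0 ≤ (n : ℤ) + 1)
      (sq_mul_add_mul_nonneg (by norm_num : |(3 : ℤ)| ≤ 3) k) (by ring)
    rw [powInt_zero, one_mul (powInt q _)] at this
    rw [show q ^ (n + 1) = powInt q (n + 1) by rw [← powInt_natCast]; simp]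
    linear_combination ((Int.negOnePow k : ℤ) : R) * qFactInv q (n - (2 * k + 1)) *
        qFactInv q (n + (2 * k + 1)) * this
  rw [h2, bilateralSum_theta_odd_eq_zero, mul_zero, add_zero, add_sub_cancel_right] at h
  rw [← h, ← powInt_natCast]
  congr 3
  push_cast
  ring

/-- Under k → -k the weighted Pascal term becomes q^(n+1) times the unweighted one. -/
theorem bilateralSum_theta_even_succ (hq : ∀ n : ℕ, IsUnit (1 - q ^ (n + 1)))
    (n : ℕ) :
    (1 - q ^ (2 * n + 2)) *
        bilateralSum q (thetaTerm q 3 1) (fun k => 2 * k + 0) (n + 1 : ℕ) (n + 1 : ℕ) =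
      (1 + q ^ (n + 1)) * bilateralSum q (thetaTerm q 3 1) (fun k => 2 * k + 0) n (n + 1) := by
  have h := bilateralSum_pascal_right hq (thetaTerm q 3 1) (injective_two_mul_add 0) (n + 1)
    (n + 1)
  have h2 : bilateralSum q (fun k => thetaTerm q 3 1 k * powInt q ((n : ℤ) + 1 - (2 * k + 0)))
      (fun k => 2 * k + 0) (n + 1) n =
      q ^ (n + 1) * bilateralSum q (thetaTerm q 3 1) (fun k => 2 * k + 0) n (n + 1) := by
    refine bilateralSum_eq_mul (Equiv.neg _) _ fun k => ?_
    simp only [Equiv.neg_apply, thetaTerm]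
    rw [show (n : ℤ) + 1 - (2 * -k + 0) = n + 1 + (2 * k + 0) by ring,
      show (n : ℤ) + (2 * -k + 0) = n - (2 * k + 0) by ring, Int.negOnePow_neg]
    rcases lt_or_ge ((n : ℤ) + 1 + (2 * k + 0)) 0 with hk | hk
    · simp only [qFactInv_of_neg q hk, mul_zero, zero_mul]
    have := powInt_add₃ q (sq_mul_add_mul_nonneg (by norm_num : |(1 : ℤ)| ≤ 3) (-k)) hk
      le_rfl (by positivity : 0 ≤ (n : ℤ) + 1)
      (sq_mul_add_mul_nonneg (by norm_num : |(1 : ℤ)| ≤ 3) k) (by ring)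
    rw [powInt_zero, one_mul (powInt q _)] at this
    rw [show q ^ (n + 1) = powInt q (n + 1) by rw [← powInt_natCast]; simp]
    linear_combination ((Int.negOnePow k : ℤ) : R) * qFactInv q (n - (2 * k + 0)) *
        qFactInv q (n + 1 + (2 * k + 0)) * this
  rw [add_sub_cancel_right, h2] at h
  push_cast
  rw [add_mul, one_mul, ← h, ← powInt_natCast]
  congr 3
  push_cast
  ring

/-- One Pascal step leaves the even sum at (n, n+1) and q^(n+2) times the (3,3) theta sum at (n,
n+1). A second step, with the antisymmetric sum vanishing, shows the latter to be -q^n times the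
even sum. The resulting factor 1 - q^(2n+2) cancels. -/
theorem bilateralSum_theta_odd_succ [CharZero R] (hq : ∀ n : ℕ, IsUnit (1 - q ^ (n + 1)))
    (n : ℕ) :
    bilateralSum q (thetaTerm q 3 1) (fun k => 2 * k + 1) (n + 1 : ℕ) (n + 1 : ℕ) =
      bilateralSum q (thetaTerm q 3 1) (fun k => 2 * k + 0) n (n + 1) := by
  have h := bilateralSum_pascal_left hq (thetaTerm q 3 1) (injective_two_mul_add 1) (n + 1)
    (n + 1)
  have h' := bilateralSum_pascal_left hq (thetaTerm q 3 3) (injective_two_mul_add 1) n (n + 1)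
  have h1 : bilateralSum q (thetaTerm q 3 1) (fun k => 2 * k + 1) (n + 1) n =
      1 * bilateralSum q (thetaTerm q 3 1) (fun k => 2 * k + 0) n (n + 1) := by
    refine bilateralSum_eq_mul (Equiv.refl _) _ fun k => ?_
    simp only [Equiv.refl_apply]
    rw [show (n : ℤ) + 1 - (2 * k + 1) = n - (2 * k + 0) by ring,
      show (n : ℤ) + (2 * k + 1) = n + 1 + (2 * k + 0) by ring, one_mul]
  have h2 : bilateralSum q (fun k => thetaTerm q 3 1 k * powInt q ((n : ℤ) + 1 + (2 * k + 1)))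
      (fun k => 2 * k + 1) n (n + 1) =
      q ^ (n + 2) * bilateralSum q (thetaTerm q 3 3) (fun k => 2 * k + 1) n (n + 1) := by
    refine bilateralSum_eq_mul (Equiv.refl _) _ fun k => ?_
    simp only [Equiv.refl_apply, thetaTerm]
    rcases lt_or_ge ((n : ℤ) + 1 + (2 * k + 1)) 0 with hk | hk
    · simp only [qFactInv_of_neg q hk, mul_zero]
    have := powInt_add₃ q (sq_mul_add_mul_nonneg (by norm_num : |(1 : ℤ)| ≤ 3) k) hk
      le_rfl (by positivity : 0 ≤ (n : ℤ) + 2)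
      (sq_mul_add_mul_nonneg (by norm_num : |(3 : ℤ)| ≤ 3) k) (by ring)
    rw [powInt_zero, one_mul (powInt q _)] at this
    rw [show q ^ (n + 2) = powInt q (n + 2) by rw [← powInt_natCast]; simp]
    linear_combination ((Int.negOnePow k : ℤ) : R) * qFactInv q (n - (2 * k + 1)) *
        qFactInv q (n + 1 + (2 * k + 1)) * this
  have h3 : bilateralSum q (fun k => thetaTerm q 3 3 k * powInt q ((n : ℤ) + 1 + (2 * k + 1)))
      (fun k => 2 * k + 1) (n - 1) (n + 1) =
      -q ^ n * bilateralSum q (thetaTerm q 3 1) (fun k => 2 * k + 0) n n := by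
    refine bilateralSum_eq_mul (Equiv.subLeft (-1)) _ fun k => ?_
    simp only [Equiv.subLeft_apply, thetaTerm]
    rw [show (n : ℤ) - 1 - (2 * (-1 - k) + 1) = n + (2 * k + 0) by ring,
      show (n : ℤ) + 1 + (2 * (-1 - k) + 1) = n - (2 * k + 0) by ring,
      Int.negOnePow_sub, Int.negOnePow_neg, Int.negOnePow_one]
    rcases lt_or_ge ((n : ℤ) - (2 * k + 0)) 0 with hk | hk
    · simp only [qFactInv_of_neg q hk, mul_zero, zero_mul]
    have := powInt_add₃ q (sq_mul_add_mul_nonneg (by norm_num : |(3 : ℤ)| ≤ 3) (-1 - k)) hk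
      le_rfl (by positivity : 0 ≤ (n : ℤ))
      (sq_mul_add_mul_nonneg (by norm_num : |(1 : ℤ)| ≤ 3) k) (by ring)
    rw [powInt_zero, one_mul (powInt q _), powInt_natCast] at this
    push_cast
    linear_combination -((Int.negOnePow k : ℤ) : R) * qFactInv q (n - (2 * k + 0)) *
        qFactInv q (n + (2 * k + 0)) * this
  rw [add_sub_cancel_right, h1, h2, one_mul] at h
  rw [add_sub_cancel_right, h3, bilateralSum_theta_odd_eq_zero, zero_add,
    ← bilateralSum_theta_recurrence hq] at h'
  rw [show powInt q ((n : ℤ) + (n + 1)) = q ^ (2 * n + 1) by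
    rw [← powInt_natCast]; congr 1; push_cast; ring] at h'
  rw [show powInt q ((n : ℤ) + 1 + (n + 1)) = q ^ (2 * n + 1 + 1) by
    rw [← powInt_natCast]; congr 1; push_cast; ring] at h
  push_cast
  apply (hq (2 * n)).mul_left_cancel
  apply (hq (2 * n + 1)).mul_left_cancel
  linear_combination (1 - q ^ (2 * n + 1)) * h + q ^ (n + 2) * h'

/-- The Bailey pair with `β_n = 1 / ((q;q)_n (q;q^2)_n)`. -/
theorem bilateralSum_theta_even_mul [CharZero R] (hq : ∀ n : ℕ, IsUnit (1 - q ^ (n + 1)))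
    (n : ℕ) :
    bilateralSum q (thetaTerm q 3 1) (fun k => 2 * k + 0) n n *
      (qPoch q (q ^ 2) n * qPoch q q n) = 1 := by
  induction n with
  | zero =>
    have := bilateralSum_zero_zero q (thetaTerm q 3 1) (injective_two_mul_add 0) (k := 0) rfl
    simp only [Nat.cast_zero]
    rw [this]
    simp [thetaTerm, powInt_zero, qPoch_zero]
  | succ n ih =>
    rw [← bilateralSum_theta_recurrence hq] at ih
    have h := bilateralSum_theta_even_succ hq n
    rw [show 1 - q ^ (2 * n + 2) = (1 + q ^ (n + 1)) * (1 - q ^ (n + 1)) by ring, mul_assoc] at h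
    have h' := (isUnit_one_add_pow hq n).mul_left_cancel h
    refine Eq.trans ?_ ih
    rw [qPoch_succ, qPoch_succ, ← h']
    ring

/-- The Bailey pair with `β_n = (1 - q^n) / ((q;q)_n (q;q^2)_n)`. -/
theorem bilateralSum_theta_odd_mul [CharZero R] (hq : ∀ n : ℕ, IsUnit (1 - q ^ (n + 1)))
    (n : ℕ) :
    bilateralSum q (thetaTerm q 3 1) (fun k => 2 * k + 1) (n + 1 : ℕ) (n + 1 : ℕ) *
      (qPoch q (q ^ 2) (n + 1) * qPoch q q n) = 1 := by
  rw [bilateralSum_theta_odd_succ hq, ← bilateralSum_theta_even_mul hq n,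
    ← bilateralSum_theta_recurrence hq, qPoch_succ]
  ring

end BaileyPair

/-! ### Iterating the Bailey chain -/

section BaileyChain

variable {R : Type*} [CommRing R] {q : R}

theorem thetaTerm_mul_powInt (q : R) {d : ℤ} (hd : d = 0 ∨ d = 1) (k : ℤ) :
    thetaTerm q 3 1 k * powInt q (3 * ((2 * k + d) ^ 2 - d)) =
      thetaTerm q 15 (12 * d + 1) k := by
  have h1 := sq_mul_add_mul_nonneg (by norm_num : |(1 : ℤ)| ≤ 3) k
  have h2 : 0 ≤ 3 * ((2 * k + d) ^ 2 - d) := by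
    rcases hd with rfl | rfl
    · rw [add_zero, sub_zero]; positivity
    · have := sq_mul_add_mul_nonneg (by norm_num : |(1 : ℤ)| ≤ 1) k
      nlinarith
  rw [thetaTerm, thetaTerm, mul_assoc, ← powInt_add q h1 h2]
  congr 2
  rcases hd with rfl | rfl <;> ring

variable [IsDomain R]

/-- Interchanging the sums over r and k, the kernel evaluates the inner sum and leaves the weight
p^(e(k)² - d). The lower bound `d` of e(k)² is split off to keep exponents nonnegative. -/
theorem sum_mul_bilateralSum {p p' X : R} {v : ℤ → R} {n : ℕ}
    (h : ∀ j : ℤ, ∑ r ∈ Finset.range (n + 1), powInt p ((r : ℤ) ^ 2 - j ^ 2) *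
        (v (n - r) * (qFactInv p (r - j) * qFactInv p (r + j))) =
      X * (qFactInv p' (n - j) * qFactInv p' (n + j)))
    (c : ℤ → R) {e : ℤ → ℤ} (he : e.Injective) {d : ℤ} (hd : ∀ k, d ≤ e k ^ 2) :
    ∑ r ∈ Finset.range (n + 1), powInt p ((r : ℤ) ^ 2 - d) * v (n - r) * bilateralSum p c e r r =
      X * bilateralSum p' (fun k => c k * powInt p (e k ^ 2 - d)) e n n := by
  simp only [bilateralSum, mul_finsum]
  rw [← finsum_sum_comm]
  · refine finsum_congr fun k => ?_
    rw [mul_left_comm, ← h, Finset.mul_sum]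
    refine Finset.sum_congr rfl fun r _ => ?_
    -- For |e k| ≤ r both exponents are nonnegative and add up; otherwise an inverse factorial
    -- vanishes, which also covers a truncated r² - d.
    by_cases hk : |e k| ≤ (r : ℤ)
    · have h1 : 0 ≤ (r : ℤ) ^ 2 - e k ^ 2 := by
        rw [← sq_abs (e k)]
        have := abs_nonneg (e k)
        nlinarith
      have h2 := powInt_add p h1 (sub_nonneg.mpr (hd k))
      rw [sub_add_sub_cancel] at h2
      rw [h2]
      ring
    · rcases lt_or_ge (r : ℤ) (e k) with h1 | h1
      · rw [qFactInv_of_neg p (m := (r : ℤ) - e k) (by omega)]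
        ring
      · have : (r : ℤ) + e k < 0 := by
          by_contra h2
          exact hk (abs_le.mpr ⟨by omega, h1⟩)
        rw [qFactInv_of_neg p this]
        ring
  · intro r _
    refine (finite_support_bilateral p c he r r).subset fun k hk => ?_
    exact right_ne_zero_of_mul hk

/-- One change of base followed by one step of the Bailey chain. -/
theorem sum_sum_mul_bilateralSum (hq : ∀ n : ℕ, IsUnit (1 - q ^ (n + 1)))
    (c : ℤ → R) {e : ℤ → ℤ} (he : e.Injective) {d : ℤ} (hd : ∀ k, d ≤ e k ^ 2) (L : ℕ) :
    ∑ n ∈ Finset.range (L + 1), powInt (q ^ 2) ((n : ℤ) ^ 2 - d) * qFactInv (q ^ 2) (L - n) *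
        (Ring.inverse (qPoch (-q) q (2 * n)) *
          ∑ r ∈ Finset.range (n + 1), powInt q ((r : ℤ) ^ 2 - d) * qFactInv (q ^ 2) (n - r) *
            bilateralSum q c e r r) =
      bilateralSum (q ^ 2) (fun k => c k * powInt q (3 * (e k ^ 2 - d))) e L L := by
  have h2 := isUnit_one_sub_pow_pow hq two_pos
  have h := sum_mul_bilateralSum (X := 1) (fun j => by rw [one_mul, sum_bailey_kernel h2 L j])
    (fun k => c k * powInt q (e k ^ 2 - d)) he hd
  rw [one_mul] at h
  have hc : (fun k => c k * powInt q (3 * (e k ^ 2 - d))) =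
      fun k => c k * powInt q (e k ^ 2 - d) * powInt (q ^ 2) (e k ^ 2 - d) := by
    funext k
    have := hd k
    rw [powInt_pow, mul_assoc, ← powInt_add q (by omega) (by push_cast; omega)]
    congr 2
    push_cast
    ring
  rw [hc, ← h]
  refine Finset.sum_congr rfl fun n _ => ?_
  rw [sum_mul_bilateralSum (sum_change_of_base_kernel hq n) c he hd,
    Ring.inverse_mul_cancel_left _ _ (isUnit_qPoch_neg hq (2 * n))]

end BaileyChain

/-! ### Infinite products, dominated convergence and the Jacobi triple product -/

section Limits

variable {R : Type*} [NormedCommRing R] [NormOneClass R] {q : R}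

theorem norm_mul_pow_le (a p : R) (j : ℕ) : ‖a * p ^ j‖ ≤ ‖a‖ * ‖p‖ ^ j :=
  (norm_mul_le _ _).trans (mul_le_mul_of_nonneg_left (norm_pow_le _ _) (norm_nonneg _))

theorem norm_mul_pow_lt_one {a p : R} (ha : ‖a‖ < 1) (hp : ‖p‖ < 1) (j : ℕ) :
    ‖a * p ^ j‖ < 1 :=
  (norm_mul_pow_le a p j).trans_lt <|
    (mul_le_of_le_one_right (norm_nonneg _) (pow_le_one₀ (norm_nonneg _) hp.le)).trans_lt ha

theorem norm_pow_lt_one {q : R} (hq : ‖q‖ < 1) {n : ℕ} (hn : n ≠ 0) : ‖q ^ n‖ < 1 :=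
  (norm_pow_le _ _).trans_lt (pow_lt_one₀ (norm_nonneg _) hq hn)

theorem summable_norm_mul_pow (a : R) {p : R} (hp : ‖p‖ < 1) :
    Summable fun j : ℕ => ‖a * p ^ j‖ :=
  Summable.of_nonneg_of_le (fun _ => norm_nonneg _) (norm_mul_pow_le a p)
    ((summable_geometric_of_lt_one (norm_nonneg p) hp).mul_left _)

theorem norm_powInt_le (q : R) (x : ℤ) : ‖powInt q x‖ ≤ ‖q‖ ^ x.toNat := norm_pow_le _ _

theorem summable_norm_thetaTerm (hq : ‖q‖ < 1) {e f : ℤ} (hf : |f| < e) :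
    Summable fun k => ‖thetaTerm q e f k‖ := by
  have h1 : Summable fun k : ℤ => ‖q‖ ^ k.natAbs := by
    have := summable_geometric_of_lt_one (norm_nonneg q) hq
    refine Summable.of_nat_of_neg ?_ ?_ <;> simpa using this
  refine Summable.of_nonneg_of_le (fun _ => norm_nonneg _) (fun k => ?_) h1
  have h2 : ‖thetaTerm q e f k‖ = ‖powInt q (e * k ^ 2 + f * k)‖ := by
    rw [thetaTerm]
    rcases Int.units_eq_one_or k.negOnePow with h | h <;> simp [h]
  rw [h2]
  refine (norm_powInt_le _ _).trans (pow_le_pow_of_le_one (norm_nonneg _) hq.le ?_)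
  have h3 := sq_mul_add_mul_nonneg (e := e - 1) (f := f) (by omega) k
  have h4 : |k| ≤ k ^ 2 := by rw [← sq_abs]; exact Int.le_self_sq _
  rw [Int.abs_eq_natAbs] at h4
  have h5 : (e - 1) * k ^ 2 + f * k = e * k ^ 2 + f * k - k ^ 2 := by ring
  omega

variable [CompleteSpace R]

theorem isUnit_one_sub_pow_succ (hq : ‖q‖ < 1) (n : ℕ) : IsUnit (1 - q ^ (n + 1)) :=
  isUnit_one_sub_of_norm_lt_one (norm_pow_lt_one hq n.succ_ne_zero)

theorem multipliable_qPochInf (a : R) {p : R} (hp : ‖p‖ < 1) :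
    Multipliable fun j : ℕ => (1 - a * p ^ j) := by
  have h : Summable fun j : ℕ => ‖-(a * p ^ j)‖ := by
    simpa only [norm_neg] using summable_norm_mul_pow a hp
  simpa only [sub_eq_add_neg] using multipliable_one_add_of_summable h

theorem tendsto_qPoch (a : R) {p : R} (hp : ‖p‖ < 1) :
    Tendsto (qPoch a p) atTop (𝓝 (qPochInf a p)) :=
  (multipliable_qPochInf a hp).hasProd.tendsto_prod_nat

theorem isUnit_qPoch {a p : R} (ha : ‖a‖ < 1) (hp : ‖p‖ < 1) (n : ℕ) : IsUnit (qPoch a p n) := by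
  induction n with
  | zero => simp [qPoch_zero]
  | succ n ih =>
    rw [qPoch_succ]
    exact ih.mul (isUnit_one_sub_of_norm_lt_one (norm_mul_pow_lt_one ha hp n))

theorem norm_inverse_one_sub_le {x : R} (hx : ‖x‖ < 1) :
    ‖Ring.inverse (1 - x)‖ ≤ (1 - ‖x‖)⁻¹ := by
  rw [← geom_series_eq_inverse x hx]
  simpa using tsum_geometric_le_of_norm_lt_one x hx

/-- Write 1/(1-x) = 1 + x/(1-x); the corrections are summable because the inverses are uniformly
bounded by 1/(1-‖a‖). -/
theorem multipliable_inverse_one_sub {a p : R} (ha : ‖a‖ < 1) (hp : ‖p‖ < 1) :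
    Multipliable fun j : ℕ => Ring.inverse (1 - a * p ^ j) := by
  have h : Summable fun j : ℕ => ‖a * p ^ j * Ring.inverse (1 - a * p ^ j)‖ := by
    refine Summable.of_nonneg_of_le (fun _ => norm_nonneg _) (fun j => ?_)
      ((summable_norm_mul_pow a hp).mul_right (1 - ‖a‖)⁻¹)
    refine (norm_mul_le _ _).trans (mul_le_mul_of_nonneg_left ?_ (norm_nonneg _))
    refine (norm_inverse_one_sub_le (norm_mul_pow_lt_one ha hp j)).trans ?_
    refine inv_anti₀ (by linarith) (sub_le_sub_left ?_ _)
    exact (norm_mul_pow_le a p j).trans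
      (mul_le_of_le_one_right (norm_nonneg _) (pow_le_one₀ (norm_nonneg _) hp.le))
  have h2 := multipliable_one_add_of_summable h
  refine h2.congr fun j => ?_
  have := Ring.mul_inverse_cancel _
    (isUnit_one_sub_of_norm_lt_one (norm_mul_pow_lt_one ha hp j))
  linear_combination -this

theorem inverse_qPoch {a p : R} (ha : ‖a‖ < 1) (hp : ‖p‖ < 1) (n : ℕ) :
    Ring.inverse (qPoch a p n) = ∏ j ∈ Finset.range n, Ring.inverse (1 - a * p ^ j) := by
  apply (isUnit_qPoch ha hp n).mul_left_cancel
  rw [Ring.mul_inverse_cancel _ (isUnit_qPoch ha hp n), qPoch, ← Finset.prod_mul_distrib]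
  refine (Finset.prod_eq_one fun j _ => ?_).symm
  exact Ring.mul_inverse_cancel _
    (isUnit_one_sub_of_norm_lt_one (norm_mul_pow_lt_one ha hp j))

/-- In a general normed ring a limit of units need not be a unit. Here the inverses of the partial
products converge too, and their limit inverts the infinite product. -/
theorem tendsto_inverse_qPoch_aux {a p : R} (ha : ‖a‖ < 1) (hp : ‖p‖ < 1) :
    ∃ I, Tendsto (fun n => Ring.inverse (qPoch a p n)) atTop (𝓝 I) ∧ qPochInf a p * I = 1 := by
  have h := (multipliable_inverse_one_sub ha hp).hasProd.tendsto_prod_nat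
  simp only [← inverse_qPoch ha hp] at h
  refine ⟨_, h, tendsto_nhds_unique ((tendsto_qPoch a hp).mul h) ?_⟩
  simp only [Ring.mul_inverse_cancel _ (isUnit_qPoch ha hp _), tendsto_const_nhds]

theorem isUnit_qPochInf {a p : R} (ha : ‖a‖ < 1) (hp : ‖p‖ < 1) : IsUnit (qPochInf a p) :=
  let ⟨_, _, h⟩ := tendsto_inverse_qPoch_aux ha hp
  IsUnit.of_mul_eq_one _ h

theorem tendsto_inverse_qPoch {a p : R} (ha : ‖a‖ < 1) (hp : ‖p‖ < 1) :
    Tendsto (fun n => Ring.inverse (qPoch a p n)) atTop (𝓝 (Ring.inverse (qPochInf a p))) := by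
  obtain ⟨I, h, h1⟩ := tendsto_inverse_qPoch_aux ha hp
  rwa [(isUnit_qPochInf ha hp).mul_left_cancel
    ((Ring.mul_inverse_cancel _ (isUnit_qPochInf ha hp)).trans h1.symm)]

theorem exists_norm_inverse_qPoch_le {a p : R} (ha : ‖a‖ < 1) (hp : ‖p‖ < 1) :
    ∃ C, 0 ≤ C ∧ ∀ n, ‖Ring.inverse (qPoch a p n)‖ ≤ C := by
  obtain ⟨C, hC⟩ := (tendsto_inverse_qPoch ha hp).norm.bddAbove_range
  have h : ∀ n, ‖Ring.inverse (qPoch a p n)‖ ≤ C := fun n => hC ⟨n, rfl⟩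
  exact ⟨C, (norm_nonneg _).trans (h 0), h⟩

theorem exists_norm_qFactInv_le {p : R} (hp : ‖p‖ < 1) :
    ∃ C, 0 ≤ C ∧ ∀ m, ‖qFactInv p m‖ ≤ C := by
  obtain ⟨C, h0, hC⟩ := exists_norm_inverse_qPoch_le hp hp
  refine ⟨C, h0, fun m => ?_⟩
  rw [qFactInv]
  split_ifs
  · exact hC _
  · simpa using h0

theorem tendsto_qFactInv {p : R} (hp : ‖p‖ < 1) :
    Tendsto (qFactInv p) atTop (𝓝 (Ring.inverse (qPochInf p p))) := by
  have h1 : Tendsto Int.toNat atTop atTop :=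
    tendsto_atTop_atTop.mpr fun b => ⟨b, fun a ha => by omega⟩
  refine ((tendsto_inverse_qPoch hp hp).comp h1).congr' ?_
  filter_upwards [eventually_ge_atTop 0] with m hm
  simp [qFactInv, hm]

theorem tendsto_natCast_add_const (x : ℤ) : Tendsto (fun L : ℕ => (L : ℤ) + x) atTop atTop :=
  tendsto_atTop_add_const_right _ _ tendsto_natCast_atTop_atTop

theorem tendsto_natCast_sub_const (x : ℤ) : Tendsto (fun L : ℕ => (L : ℤ) - x) atTop atTop := by
  simpa only [sub_eq_add_neg] using tendsto_natCast_add_const (-x)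

/-- Dominated convergence: inverse factorials are uniformly bounded, and each of the two tends to
1/(p;p)_∞. -/
theorem tendsto_bilateralSum {p : R} (hp : ‖p‖ < 1) {c : ℤ → R} (hc : Summable fun k => ‖c k‖)
    {e : ℤ → ℤ} (he : e.Injective) :
    Tendsto (fun L : ℕ => bilateralSum p c e L L) atTop
      (𝓝 ((∑' k, c k) * (Ring.inverse (qPochInf p p) * Ring.inverse (qPochInf p p)))) := by
  obtain ⟨C, h0, hC⟩ := exists_norm_qFactInv_le hp
  rw [← hc.of_norm.tsum_mul_right]
  have h : ∀ L : ℕ, bilateralSum p c e L L =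
      ∑' k, c k * (qFactInv p (L - e k) * qFactInv p (L + e k)) := fun L =>
    (tsum_eq_finsum (finite_support_bilateral p c he L L)).symm
  simp only [h]
  refine tendsto_tsum_of_dominated_convergence (bound := fun k => ‖c k‖ * (C * C))
    (hc.mul_right _) (fun k => ?_) (Eventually.of_forall fun L k => ?_)
  · exact (((tendsto_qFactInv hp).comp (tendsto_natCast_sub_const _)).mul
      ((tendsto_qFactInv hp).comp (tendsto_natCast_add_const _))).const_mul _
  · refine (norm_mul_le _ _).trans (mul_le_mul_of_nonneg_left ?_ (norm_nonneg _))
    exact (norm_mul_le _ _).trans (mul_le_mul (hC _) (hC _) (norm_nonneg _) h0)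

/-- The Jacobi triple product identity. -/
theorem tsum_thetaTerm [IsDomain R] (hq : ‖q‖ < 1) {e f : ℕ} (hf : f < e) :
    ∑' k, thetaTerm q e f k =
      qPochInf₃ (q ^ (e - f)) (q ^ (e + f)) (q ^ (2 * e)) (q ^ (2 * e)) := by
  have hp : ‖q ^ (2 * e)‖ < 1 := norm_pow_lt_one hq (by omega)
  have hu := isUnit_qPochInf hp hp
  set p := q ^ (2 * e)
  have h1 := tendsto_bilateralSum hp
    (summable_norm_thetaTerm hq (e := e) (f := f) (by
      rw [abs_of_nonneg (by positivity)]; exact_mod_cast hf)) Function.injective_id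
  have h2 : Tendsto (fun L : ℕ => bilateralSum p (thetaTerm q e f) id L L) atTop
      (𝓝 (Ring.inverse (qPochInf p p) *
        (qPochInf (q ^ (e + f)) p * qPochInf (q ^ (e - f)) p))) := by
    simp only [p, bilateralSum_thetaTerm (isUnit_one_sub_pow_succ hq) (by omega : 0 < e) hf.le]
    refine Tendsto.mul ?_ ((tendsto_qPoch _ hp).mul (tendsto_qPoch _ hp))
    refine (tendsto_qFactInv hp).comp (tendsto_natCast_atTop_atTop.comp ?_)
    exact tendsto_id.const_mul_atTop' two_pos
  have h3 := tendsto_nhds_unique h1 h2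
  have h4 := Ring.mul_inverse_cancel _ hu
  rw [qPochInf₃]
  set I := Ring.inverse (qPochInf p p)
  linear_combination (qPochInf p p * qPochInf p p) * h3 - ((∑' k, thetaTerm q e f k) *
    (qPochInf p p * I + 1) - qPochInf (q ^ (e + f)) p * qPochInf (q ^ (e - f)) p *
      qPochInf p p) * h4

end Limits

/-! ### The double series as a limit of the chain -/

section DoubleSum

variable {R : Type*} [NormedCommRing R] [NormOneClass R] [CompleteSpace R] {q : R}

omit [NormOneClass R] [CompleteSpace R] in
theorem summable_pow_sq_sub {q : R} (hq : ‖q‖ < 1) {d : ℤ} (hd : d ≤ 1) :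
    Summable fun n : ℕ => ‖q‖ ^ ((n : ℤ) ^ 2 - d).toNat := by
  rw [← summable_nat_add_iff 1]
  refine Summable.of_nonneg_of_le (fun n => by positivity) (fun n => ?_)
    (summable_geometric_of_lt_one (norm_nonneg q) hq)
  refine pow_le_pow_of_le_one (norm_nonneg _) hq.le ?_
  have : ((n + 1 : ℕ) : ℤ) ^ 2 = (n : ℤ) ^ 2 + 2 * n + 1 := by push_cast; ring
  have := sq_nonneg (n : ℤ)
  omega

/-- The summand of the double series attached to a sequence `β`. -/
noncomputable def doubleTerm {R : Type*} [CommRing R] (q : R) (β : ℕ → R) (d : ℤ) (x : ℕ × ℕ) : R :=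
  powInt (q ^ 2) ((x.1 : ℤ) ^ 2 - d) * Ring.inverse (qPoch (-q) q (2 * x.1)) *
    (powInt q ((x.2 : ℤ) ^ 2 - d) * qFactInv (q ^ 2) ((x.1 : ℤ) - x.2) * β x.2)

theorem summable_norm_doubleTerm (hq : ‖q‖ < 1) {β : ℕ → R} {Cβ : ℝ} (hβ : ∀ r, ‖β r‖ ≤ Cβ)
    {d : ℤ} (hd : d ≤ 1) : Summable fun x => ‖doubleTerm q β d x‖ := by
  have hq2 : ‖q ^ 2‖ < 1 := norm_pow_lt_one hq two_ne_zero
  obtain ⟨C, h0, hC⟩ := exists_norm_qFactInv_le hq2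
  obtain ⟨D, h0', hD⟩ := exists_norm_inverse_qPoch_le (a := -q) (by simpa using hq) hq
  have hCβ : 0 ≤ Cβ := (norm_nonneg _).trans (hβ 0)
  refine Summable.of_nonneg_of_le (fun _ => norm_nonneg _) (fun x => ?_)
    (((summable_pow_sq_sub hq2 hd).mul_right D).mul_of_nonneg
      ((summable_pow_sq_sub hq hd).mul_right (C * Cβ)) (fun _ => by positivity)
      (fun _ => by positivity))
  rw [doubleTerm]
  refine (norm_mul_le _ _).trans (mul_le_mul ?_ ?_ (norm_nonneg _) (by positivity))
  · exact (norm_mul_le _ _).trans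
      (mul_le_mul (norm_powInt_le _ _) (hD _) (norm_nonneg _) (by positivity))
  · rw [mul_assoc]
    refine (norm_mul_le _ _).trans
      (mul_le_mul (norm_powInt_le _ _) ?_ (norm_nonneg _) (by positivity))
    exact (norm_mul_le _ _).trans (mul_le_mul (hC _) (hβ _) (norm_nonneg _) h0)

/-- Let L → ∞ in `sum_sum_mul_bilateralSum`. The theta side acquires 1/(q²;q²)_∞ twice and the
double series once, so one factor cancels. -/
theorem hasSum_doubleTerm [IsDomain R] (hq : ‖q‖ < 1) {c : ℤ → R} {e : ℤ → ℤ}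
    (he : e.Injective) {d : ℤ} (hd : d ≤ 1) (hde : ∀ k, d ≤ e k ^ 2) {β : ℕ → R}
    (hβ : ∀ r : ℕ, bilateralSum q c e r r = β r) {Cβ : ℝ} (hCβ : ∀ r, ‖β r‖ ≤ Cβ)
    (hc : Summable fun k => ‖c k * powInt q (3 * (e k ^ 2 - d))‖) :
    HasSum (doubleTerm q β d) ((∑' k, c k * powInt q (3 * (e k ^ 2 - d))) *
      Ring.inverse (qPochInf (q ^ 2) (q ^ 2))) := by
  have hq2 : ‖q ^ 2‖ < 1 := norm_pow_lt_one hq two_ne_zero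
  have hs := summable_norm_doubleTerm hq hCβ hd
  have hu := Ring.mul_inverse_cancel _ (isUnit_qPochInf hq2 hq2)
  obtain ⟨C, h0, hC⟩ := exists_norm_qFactInv_le hq2
  have h1 := tendsto_bilateralSum hq2 hc he
  have h2 : Tendsto (fun L : ℕ => ∑' x : ℕ × ℕ, doubleTerm q β d x *
      qFactInv (q ^ 2) ((L : ℤ) - x.1)) atTop
      (𝓝 (∑' x, doubleTerm q β d x * Ring.inverse (qPochInf (q ^ 2) (q ^ 2)))) := by
    refine tendsto_tsum_of_dominated_convergence (bound := fun x => ‖doubleTerm q β d x‖ * C)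
      (hs.mul_right _) (fun x => ?_) (Eventually.of_forall fun L x => ?_)
    · exact ((tendsto_qFactInv hq2).comp (tendsto_natCast_sub_const _)).const_mul _
    · exact (norm_mul_le _ _).trans (mul_le_mul_of_nonneg_left (hC _) (norm_nonneg _))
  have h3 : ∀ L : ℕ, ∑' x : ℕ × ℕ, doubleTerm q β d x * qFactInv (q ^ 2) ((L : ℤ) - x.1) =
      bilateralSum (q ^ 2) (fun k => c k * powInt q (3 * (e k ^ 2 - d))) e L L := by
    intro L
    rw [← sum_sum_mul_bilateralSum (isUnit_one_sub_pow_succ hq) c he hde,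
      tsum_eq_sum (s := Finset.range (L + 1) ×ˢ Finset.range (L + 1)), Finset.sum_product]
    · refine Finset.sum_congr rfl fun n hn => ?_
      have hn' := Finset.mem_range_succ_iff.mp hn
      rw [Finset.mul_sum, Finset.mul_sum]
      rw [← Finset.sum_subset (Finset.range_subset_range.mpr (by omega : n + 1 ≤ L + 1))]
      · refine Finset.sum_congr rfl fun r _ => ?_
        rw [doubleTerm, hβ]
        ring
      · intro r _ hr
        rw [Finset.mem_range] at hr
        rw [doubleTerm, qFactInv_of_neg (q ^ 2) (m := (n : ℤ) - r) (by omega)]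
        ring
    · rintro ⟨n, r⟩ hx
      rw [Finset.mem_product, Finset.mem_range, Finset.mem_range] at hx
      rcases lt_or_ge L n with h | h
      · rw [qFactInv_of_neg (q ^ 2) (m := (L : ℤ) - n) (by omega)]
        ring
      · rw [doubleTerm, qFactInv_of_neg (q ^ 2) (m := (n : ℤ) - r) (by omega)]
        ring
  simp only [h3] at h2
  have h4 := tendsto_nhds_unique h1 h2
  rw [hs.of_norm.tsum_mul_right] at h4
  have h5 : (∑' k, c k * powInt q (3 * (e k ^ 2 - d))) *
      Ring.inverse (qPochInf (q ^ 2) (q ^ 2)) = ∑' x, doubleTerm q β d x := by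
    linear_combination qPochInf (q ^ 2) (q ^ 2) * h4 -
      ((∑' k, c k * powInt q (3 * (e k ^ 2 - d))) * Ring.inverse (qPochInf (q ^ 2) (q ^ 2)) -
        ∑' x, doubleTerm q β d x) * hu
  rw [h5]
  exact hs.of_norm.hasSum

theorem exists_norm_inverse_mul_qPoch_le (hq : ‖q‖ < 1) :
    ∃ C, 0 ≤ C ∧ ∀ m n, ‖Ring.inverse (qPoch q (q ^ 2) m * qPoch q q n)‖ ≤ C := by
  obtain ⟨C, h0, hC⟩ := exists_norm_inverse_qPoch_le hq hq
  obtain ⟨D, h0', hD⟩ := exists_norm_inverse_qPoch_le hq (norm_pow_lt_one hq two_ne_zero)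
  refine ⟨C * D, by positivity, fun m n => ?_⟩
  rw [Ring.mul_inverse_rev]
  exact (norm_mul_le _ _).trans (mul_le_mul (hC _) (hD _) (norm_nonneg _) h0)

variable [IsDomain R] [CharZero R]

/-- The first identity in a complete normed domain. -/
theorem hasSum_modThirty_first (hq : ‖q‖ < 1) :
    HasSum (fun p : ℕ × ℕ => q ^ (2 * p.1 ^ 2 + 3 * p.2 ^ 2 + 4 * p.1 * p.2) *
        Ring.inverse (qPoch (-q) q (2 * p.1 + 2 * p.2) * qPoch q (q ^ 2) p.2 * qPoch q q p.2 *
              qPoch (q ^ 2) (q ^ 2) p.1))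
      (qPochInf₃ (q ^ 14) (q ^ 16) (q ^ 30) (q ^ 30) *
        Ring.inverse (qPochInf (q ^ 2) (q ^ 2))) := by
  obtain ⟨C, -, hC⟩ := exists_norm_inverse_mul_qPoch_le hq
  have hu := isUnit_one_sub_pow_succ hq
  have hq2 : ‖q ^ 2‖ < 1 := norm_pow_lt_one hq two_ne_zero
  have hc : ∀ k : ℤ, thetaTerm q 3 1 k * powInt q (3 * ((2 * k + 0) ^ 2 - 0)) =
      thetaTerm q 15 1 k := thetaTerm_mul_powInt q (Or.inl rfl)
  have hβ : ∀ r : ℕ, bilateralSum q (thetaTerm q 3 1) (fun k => 2 * k + 0) r r =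
      Ring.inverse (qPoch q (q ^ 2) r * qPoch q q r) := fun r => by
    have h1 := (isUnit_qPoch hq hq2 r).mul (isUnit_qPoch hq hq r)
    apply h1.mul_right_cancel
    rw [Ring.inverse_mul_cancel _ h1, bilateralSum_theta_even_mul hu]
  have h := hasSum_doubleTerm hq (injective_two_mul_add 0) zero_le_one
    (fun k => sq_nonneg _) hβ (fun r => hC r r)
    (by simpa only [hc] using summable_norm_thetaTerm hq (by norm_num))
  have hθ := tsum_thetaTerm hq (e := 15) (f := 1) (by norm_num)
  norm_num only at hθ
  simp only [hc] at h
  rw [hθ] at h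
  -- The chain sums over r ≤ n. Replacing n by n + r makes the indices independent and turns 2n² +
  -- r² into 2n² + 4nr + 3r².
  have hg : Function.Injective fun p : ℕ × ℕ => (p.1 + p.2, p.2) := by
    rintro ⟨a, b⟩ ⟨c, d⟩ h
    simp only [Prod.mk.injEq] at h ⊢
    omega
  rw [← hg.hasSum_iff] at h
  · convert h using 2 with p
    obtain ⟨m, r⟩ := p
    simp only [Function.comp, doubleTerm]
    rw [show ((m + r : ℕ) : ℤ) ^ 2 - 0 = ((m + r) ^ 2 : ℕ) by push_cast; ring,
      show (r : ℤ) ^ 2 - 0 = (r ^ 2 : ℕ) by push_cast; ring,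
      show ((m + r : ℕ) : ℤ) - r = m by push_cast; ring, powInt_natCast, powInt_natCast,
      qFactInv_natCast, mul_add, Ring.mul_inverse_rev, Ring.mul_inverse_rev, Ring.mul_inverse_rev,
      Ring.mul_inverse_rev]
    ring
  · rintro ⟨n, r⟩ hx
    have : n < r := by
      by_contra h
      exact hx ⟨(n - r, r), Prod.ext (show n - r + r = n by omega) rfl⟩
    rw [doubleTerm, qFactInv_of_neg (q ^ 2) (m := (n : ℤ) - r) (by omega)]
    ring

/-- The second identity in a complete normed domain. -/
theorem hasSum_modThirty_second (hq : ‖q‖ < 1) :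
    HasSum (fun p : ℕ × ℕ =>
        q ^ (2 * p.1 ^ 2 + 3 * p.2 ^ 2 + 4 * p.1 * p.2 + 4 * p.1 + 6 * p.2) *
          Ring.inverse (qPoch (-q) q (2 * p.1 + 2 * p.2 + 2) * qPoch q (q ^ 2) (p.2 + 1) *
            qPoch q q p.2 * qPoch (q ^ 2) (q ^ 2) p.1))
      (qPochInf₃ (q ^ 2) (q ^ 28) (q ^ 30) (q ^ 30) *
        Ring.inverse (qPochInf (q ^ 2) (q ^ 2))) := by
  obtain ⟨C, hC0, hC⟩ := exists_norm_inverse_mul_qPoch_le hq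
  have hu := isUnit_one_sub_pow_succ hq
  have hq2 : ‖q ^ 2‖ < 1 := norm_pow_lt_one hq two_ne_zero
  have hc : ∀ k : ℤ, thetaTerm q 3 1 k * powInt q (3 * ((2 * k + 1) ^ 2 - 1)) =
      thetaTerm q 15 13 k := thetaTerm_mul_powInt q (Or.inr rfl)
  -- No odd index contributes at r = 0, so β_0 = 0. This removes the row r = 0, where r² - 1 is
  -- truncated and which the shifted reindexing misses.
  set β : ℕ → R := fun r =>
    if r = 0 then 0 else Ring.inverse (qPoch q (q ^ 2) r * qPoch q q (r - 1)) with hβdef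
  have hβ : ∀ r : ℕ, bilateralSum q (thetaTerm q 3 1) (fun k => 2 * k + 1) r r = β r := fun r => by
    rcases r with _ | r
    · exact bilateralSum_theta_odd_zero q _
    · have h1 := (isUnit_qPoch hq hq2 (r + 1)).mul (isUnit_qPoch hq hq r)
      apply h1.mul_right_cancel
      rw [bilateralSum_theta_odd_mul hu]
      exact (Ring.inverse_mul_cancel _ h1).symm
  have hβC : ∀ r, ‖β r‖ ≤ C := fun r => by
    rw [hβdef]
    simp only
    split_ifs
    · simpa using hC0
    · exact hC _ _
  have hone : ∀ k : ℤ, 1 ≤ (2 * k + 1) ^ 2 := fun k => by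
    have := sq_mul_add_mul_nonneg (by norm_num : |(1 : ℤ)| ≤ 1) k
    nlinarith
  have h := hasSum_doubleTerm hq (injective_two_mul_add 1) le_rfl hone hβ hβC
    (by simpa only [hc] using summable_norm_thetaTerm hq (by norm_num))
  have hθ := tsum_thetaTerm hq (e := 15) (f := 13) (by norm_num)
  norm_num only at hθ
  simp only [hc] at h
  rw [hθ] at h
  have hg : Function.Injective fun p : ℕ × ℕ => (p.1 + p.2 + 1, p.2 + 1) := by
    rintro ⟨a, b⟩ ⟨c, d⟩ h
    simp only [Prod.mk.injEq] at h ⊢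
    omega
  rw [← hg.hasSum_iff] at h
  · convert h using 2 with p
    obtain ⟨m, r⟩ := p
    simp only [Function.comp, doubleTerm, hβdef, Nat.add_eq_zero_iff, one_ne_zero, and_false,
      if_false, Nat.add_sub_cancel]
    rw [show ((m + r + 1 : ℕ) : ℤ) ^ 2 - 1 = ((m + r) ^ 2 + 2 * (m + r) : ℕ) by push_cast; ring,
      show ((r + 1 : ℕ) : ℤ) ^ 2 - 1 = (r ^ 2 + 2 * r : ℕ) by push_cast; ring,
      show ((m + r + 1 : ℕ) : ℤ) - (r + 1 : ℕ) = m by push_cast; ring, powInt_natCast,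
      powInt_natCast, qFactInv_natCast, show 2 * (m + r + 1) = 2 * m + 2 * r + 2 by ring,
      Ring.mul_inverse_rev, Ring.mul_inverse_rev, Ring.mul_inverse_rev, Ring.mul_inverse_rev]
    ring
  · rintro ⟨n, r⟩ hx
    rcases r with _ | r
    · rw [doubleTerm]
      simp [hβdef]
    have : n < r + 1 := by
      by_contra h
      exact hx ⟨(n - (r + 1), r), Prod.ext (show n - (r + 1) + r + 1 = n by omega) rfl⟩
    rw [doubleTerm, qFactInv_of_neg (q ^ 2) (m := (n : ℤ) - (r + 1 : ℕ)) (by omega)]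
    ring

end DoubleSum

/-! ### Formal power series as a complete normed domain -/

/-- The ring `ℤ⟦X⟧`, to be equipped with the `X`-adic norm. -/
def AdicPowerSeries : Type := PowerSeries ℤ

namespace AdicPowerSeries

noncomputable instance : CommRing AdicPowerSeries := inferInstanceAs (CommRing (PowerSeries ℤ))

instance : IsDomain AdicPowerSeries := inferInstanceAs (IsDomain (PowerSeries ℤ))

/-- The identity map onto `ℤ⟦X⟧`. -/
noncomputable def toPowerSeries : AdicPowerSeries ≃+* PowerSeries ℤ := RingEquiv.refl (PowerSeries ℤ)

instance : CharZero AdicPowerSeries :=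
  charZero_of_injective_ringHom
    (f := (toPowerSeries.symm : PowerSeries ℤ →+* AdicPowerSeries).comp PowerSeries.C)
    (toPowerSeries.symm.injective.comp PowerSeries.C_injective)

open Classical in
/-- The `X`-adic norm `2 ^ (-order)`. -/
noncomputable def adicNorm (f : AdicPowerSeries) : ℝ :=
  if toPowerSeries f = 0 then 0 else (1 / 2) ^ (toPowerSeries f).order.toNat

theorem adicNorm_nonneg (f : AdicPowerSeries) : 0 ≤ adicNorm f := by
  rw [adicNorm]; split_ifs <;> positivity

theorem adicNorm_le_iff (f : AdicPowerSeries) (n : ℕ) :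
    adicNorm f ≤ (1 / 2) ^ n ↔ ∀ i < n, PowerSeries.coeff i (toPowerSeries f) = 0 := by
  rw [adicNorm]
  split_ifs with h
  · simp [h]
  · rw [pow_le_pow_iff_right_of_lt_one₀ (by norm_num) (by norm_num), ← Nat.cast_le (α := ℕ∞),
      ENat.natCast_toNat (by simpa [PowerSeries.order_eq_top] using h)]
    constructor
    · intro hn i hi
      exact PowerSeries.coeff_of_lt_order _ (lt_of_lt_of_le (by exact_mod_cast hi) hn)
    · intro hn
      exact PowerSeries.nat_le_order _ _ hn

theorem adicNorm_eq_zero_or (f : AdicPowerSeries) :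
    adicNorm f = 0 ∨ ∃ n : ℕ, adicNorm f = (1 / 2) ^ n := by
  rw [adicNorm]
  split_ifs
  · exact Or.inl rfl
  · exact Or.inr ⟨_, rfl⟩

theorem eq_zero_of_adicNorm {f : AdicPowerSeries} (h : adicNorm f = 0) : f = 0 := by
  rw [adicNorm] at h
  split_ifs at h with h1
  · exact h1
  · exact absurd h (by positivity)

theorem adicNorm_zero : adicNorm 0 = 0 := by simp [adicNorm]

theorem adicNorm_add_le_max (f g : AdicPowerSeries) :
    adicNorm (f + g) ≤ max (adicNorm f) (adicNorm g) := by
  rcases adicNorm_eq_zero_or f with hf | ⟨m, hf⟩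
  · simp [eq_zero_of_adicNorm hf]
  rcases adicNorm_eq_zero_or g with hg | ⟨n, hg⟩
  · simp [eq_zero_of_adicNorm hg]
  wlog h : m ≤ n generalizing f g m n
  · rw [add_comm, max_comm]
    exact this g f n hg m hf (by omega)
  · refine le_max_of_le_left ?_
    have h1 := (adicNorm_le_iff f m).mp hf.le
    have h2 := (adicNorm_le_iff g n).mp hg.le
    rw [hf, adicNorm_le_iff]
    intro i hi
    rw [map_add, map_add, h1 i hi, h2 i (by omega), add_zero]

theorem adicNorm_neg (f : AdicPowerSeries) : adicNorm (-f) = adicNorm f := by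
  have h : toPowerSeries (-f) = -toPowerSeries f := map_neg _ _
  by_cases h0 : toPowerSeries f = 0
  · rw [adicNorm, adicNorm, h, h0, neg_zero]
  · rw [adicNorm, adicNorm, h, if_neg h0, if_neg (neg_ne_zero.mpr h0), PowerSeries.order_neg]

theorem adicNorm_mul (f g : AdicPowerSeries) : adicNorm (f * g) = adicNorm f * adicNorm g := by
  by_cases hf : toPowerSeries f = 0
  · simp [adicNorm, hf]
  by_cases hg : toPowerSeries g = 0
  · simp [adicNorm, hg]
  rw [adicNorm, adicNorm, adicNorm, if_neg hf, if_neg hg, map_mul, if_neg (mul_ne_zero hf hg),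
    PowerSeries.order_mul, ENat.toNat_add, pow_add]
  · simpa [PowerSeries.order_eq_top] using hf
  · simpa [PowerSeries.order_eq_top] using hg

noncomputable instance : NormedCommRing AdicPowerSeries :=
  { RingNorm.toNormedRing
      { toFun := adicNorm
        map_zero' := adicNorm_zero
        add_le' := fun f g => (adicNorm_add_le_max f g).trans
          (max_le_add_of_nonneg (adicNorm_nonneg f) (adicNorm_nonneg g))
        neg' := adicNorm_neg
        mul_le' := fun f g => (adicNorm_mul f g).le
        eq_zero_of_map_eq_zero' := fun _ => eq_zero_of_adicNorm } with
    mul_comm := mul_comm }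

theorem norm_eq (f : AdicPowerSeries) : ‖f‖ = adicNorm f := rfl

instance : NormOneClass AdicPowerSeries := ⟨by simp [norm_eq, adicNorm]⟩

theorem norm_le_iff (f : AdicPowerSeries) (n : ℕ) :
    ‖f‖ ≤ (1 / 2) ^ n ↔ ∀ i < n, PowerSeries.coeff i (toPowerSeries f) = 0 :=
  adicNorm_le_iff f n

theorem coeff_eq_of_dist_lt {f g : AdicPowerSeries} {n : ℕ} (h : dist f g < (1 / 2) ^ n) :
    PowerSeries.coeff n (toPowerSeries f) = PowerSeries.coeff n (toPowerSeries g) := by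
  rw [dist_eq_norm] at h
  rcases adicNorm_eq_zero_or (f - g) with h1 | ⟨m, h1⟩
  · rw [sub_eq_zero.mp (eq_zero_of_adicNorm h1)]
  · rw [norm_eq, h1, pow_lt_pow_iff_right_of_lt_one₀ (by norm_num) (by norm_num)] at h
    have := (adicNorm_le_iff _ m).mp h1.le n h
    rwa [map_sub, map_sub, sub_eq_zero] at this

theorem continuous_toPowerSeries : Continuous toPowerSeries := by
  refine continuous_iff_continuousAt.mpr fun f => ?_
  rw [ContinuousAt, PowerSeries.WithPiTopology.tendsto_iff_coeff_tendsto]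
  intro n
  refine tendsto_const_nhds.congr' ?_
  filter_upwards [Metric.ball_mem_nhds f (by positivity : (0 : ℝ) < (1 / 2) ^ n)] with g hg
  exact (coeff_eq_of_dist_lt hg).symm

/-- Along a Cauchy sequence each coefficient is eventually constant; the series of these eventual
values is the limit. -/
instance : CompleteSpace AdicPowerSeries := by
  refine Metric.complete_of_cauchySeq_tendsto fun u hu => ?_
  have h : ∀ n : ℕ, ∃ N, ∀ m ≥ N, dist (u m) (u N) < (1 / 2) ^ n := fun n =>
    Metric.cauchySeq_iff'.mp hu _ (by positivity)
  choose N hN using h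
  let g : AdicPowerSeries := toPowerSeries.symm
    (PowerSeries.mk fun n => PowerSeries.coeff n (toPowerSeries (u (N n))))
  refine ⟨g, Metric.tendsto_atTop.mpr fun ε hε => ?_⟩
  obtain ⟨n, hn⟩ := exists_pow_lt_of_lt_one hε (by norm_num : (1 / 2 : ℝ) < 1)
  refine ⟨(Finset.range n).sup N, fun m hm => lt_of_le_of_lt ?_ hn⟩
  rw [dist_eq_norm, norm_le_iff]
  intro i hi
  have h1 := coeff_eq_of_dist_lt
    (hN i m ((Finset.le_sup (Finset.mem_range.mpr hi)).trans hm))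
  rw [map_sub, map_sub, h1, RingEquiv.apply_symm_apply, PowerSeries.coeff_mk, sub_self]

end AdicPowerSeries

/-! ### Transport to the coefficientwise topology -/

theorem map_qPoch {R S : Type*} [CommRing R] [CommRing S] (φ : R →+* S) (a q : R) (n : ℕ) :
    φ (qPoch a q n) = qPoch (φ a) (φ q) n := by
  simp [qPoch, map_prod]

theorem map_qPochInf {R S : Type*} [CommRing R] [TopologicalSpace R] [CommRing S]
    [TopologicalSpace S] [T2Space S] (φ : R →+* S) (hφ : Continuous φ) {a q : R}
    (h : Multipliable fun j : ℕ => (1 - a * q ^ j)) :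
    φ (qPochInf a q) = qPochInf (φ a) (φ q) := by
  rw [qPochInf, h.map_tprod φ hφ]
  simp [qPochInf]

namespace AdicPowerSeries

/-- The indeterminate. -/
noncomputable def X : AdicPowerSeries := toPowerSeries.symm PowerSeries.X

theorem toPowerSeries_X : toPowerSeries X = PowerSeries.X := RingEquiv.apply_symm_apply _ _

theorem norm_X_lt_one : ‖X‖ < 1 := by
  have h : ‖X‖ ≤ (1 / 2) ^ 1 := by
    rw [norm_le_iff]
    intro i hi
    obtain rfl : i = 0 := by omega
    rw [toPowerSeries_X, PowerSeries.coeff_zero_X]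
  exact h.trans_lt (by norm_num)

theorem toPowerSeries_qPoch (a q : AdicPowerSeries) (n : ℕ) :
    toPowerSeries (qPoch a q n) = qPoch (toPowerSeries a) (toPowerSeries q) n :=
  map_qPoch (toPowerSeries : AdicPowerSeries →+* PowerSeries ℤ) a q n

theorem toPowerSeries_qPochInf (a : AdicPowerSeries) {q : AdicPowerSeries} (hq : ‖q‖ < 1) :
    toPowerSeries (qPochInf a q) = qPochInf (toPowerSeries a) (toPowerSeries q) :=
  map_qPochInf (toPowerSeries : AdicPowerSeries →+* PowerSeries ℤ) continuous_toPowerSeries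
    (multipliable_qPochInf a hq)

/-- Constant term 1 makes the series a unit, so both notions of inverse agree by uniqueness. -/
theorem toPowerSeries_inverse {f : AdicPowerSeries}
    (hf : PowerSeries.constantCoeff (toPowerSeries f) = 1) :
    toPowerSeries (Ring.inverse f) = PowerSeries.invOfUnit (toPowerSeries f) 1 := by
  have h1 := PowerSeries.mul_invOfUnit (toPowerSeries f) 1 (by simpa using hf)
  have hu : IsUnit f := by
    rw [← MulEquiv.isUnit_map toPowerSeries.toMulEquiv]
    exact IsUnit.of_mul_eq_one _ h1
  have h2 := congrArg toPowerSeries (Ring.mul_inverse_cancel _ hu)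
  rw [map_mul, map_one, ← h1] at h2
  exact (IsUnit.of_mul_eq_one _ h1).mul_left_cancel h2

theorem constantCoeff_qPoch {a q : PowerSeries ℤ} (ha : PowerSeries.constantCoeff a = 0) (n : ℕ) :
    PowerSeries.constantCoeff (qPoch a q n) = 1 := by
  rw [map_qPoch, ha]
  simp [qPoch]

theorem constantCoeff_qPochInf {a : PowerSeries ℤ} (ha : PowerSeries.constantCoeff a = 0) {k : ℕ}
    (hk : 0 < k) : PowerSeries.constantCoeff (qPochInf a (PowerSeries.X ^ k)) = 1 := by
  rw [map_qPochInf _ (PowerSeries.WithPiTopology.continuous_constantCoeff ℤ)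
    (multipliable_qPochInf_powerSeries a hk), ha]
  simp [qPochInf]

theorem toPowerSeries_qPochInf₃_mul_inverse (a b c : ℕ) {d e : ℕ} (hd : 0 < d) (he : 0 < e) :
    toPowerSeries (qPochInf₃ (X ^ a) (X ^ b) (X ^ c) (X ^ d) *
        Ring.inverse (qPochInf (X ^ e) (X ^ e))) =
      qPochInf₃ (PowerSeries.X ^ a) (PowerSeries.X ^ b) (PowerSeries.X ^ c) (PowerSeries.X ^ d) *
        PowerSeries.invOfUnit (qPochInf (PowerSeries.X ^ e) (PowerSeries.X ^ e)) 1 := by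
  have h1 := norm_pow_lt_one norm_X_lt_one hd.ne'
  have h2 := norm_pow_lt_one norm_X_lt_one he.ne'
  rw [map_mul, toPowerSeries_inverse]
  · simp only [qPochInf₃, map_mul, toPowerSeries_qPochInf _ h1, toPowerSeries_qPochInf _ h2,
      map_pow, toPowerSeries_X]
  · rw [toPowerSeries_qPochInf _ h2, map_pow, toPowerSeries_X]
    exact constantCoeff_qPochInf (by simp [he.ne']) he

theorem toPowerSeries_pow_mul_inverse (i k l m n : ℕ) :
    toPowerSeries (X ^ i * Ring.inverse (qPoch (-X) X k * qPoch X (X ^ 2) l * qPoch X X m *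
        qPoch (X ^ 2) (X ^ 2) n)) =
      PowerSeries.X ^ i * PowerSeries.invOfUnit (qPoch (-PowerSeries.X) PowerSeries.X k *
        qPoch PowerSeries.X (PowerSeries.X ^ 2) l * qPoch PowerSeries.X PowerSeries.X m *
        qPoch (PowerSeries.X ^ 2) (PowerSeries.X ^ 2) n) 1 := by
  rw [map_mul, toPowerSeries_inverse]
  · simp only [map_mul, map_pow, map_neg, toPowerSeries_qPoch, toPowerSeries_X]
  · simp only [map_mul, map_pow, map_neg, toPowerSeries_qPoch, toPowerSeries_X]
    rw [constantCoeff_qPoch (by simp), constantCoeff_qPoch (by simp), constantCoeff_qPoch (by simp),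
      constantCoeff_qPoch (by simp)]
    norm_num

end AdicPowerSeries

/-- Two Rogers–Ramanujan type identities modulo 30, both as identities between complex numbers
for `|q| < 1` (the double series converging absolutely) and as identities of formal power series
in `X = q` with integer coefficients, where `ℤ⟦X⟧` carries the topology of coefficientwise
stabilization and `PowerSeries.invOfUnit f 1` is `1 / f` for `f` with constant term `1`. -/
theorem mainTheorem4 :
    (∀ q : ℂ, ‖q‖ < 1 →
      HasSum
        (fun p : ℕ × ℕ =>
          q ^ (2 * p.1 ^ 2 + 3 * p.2 ^ 2 + 4 * p.1 * p.2) /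
            (qPoch (-q) q (2 * p.1 + 2 * p.2) * qPoch q (q ^ 2) p.2 * qPoch q q p.2 *
              qPoch (q ^ 2) (q ^ 2) p.1))
        (qPochInf₃ (q ^ 14) (q ^ 16) (q ^ 30) (q ^ 30) / qPochInf (q ^ 2) (q ^ 2)) ∧
      HasSum
        (fun p : ℕ × ℕ =>
          q ^ (2 * p.1 ^ 2 + 3 * p.2 ^ 2 + 4 * p.1 * p.2 + 4 * p.1 + 6 * p.2) /
            (qPoch (-q) q (2 * p.1 + 2 * p.2 + 2) * qPoch q (q ^ 2) (p.2 + 1) * qPoch q q p.2 *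
              qPoch (q ^ 2) (q ^ 2) p.1))
        (qPochInf₃ (q ^ 2) (q ^ 28) (q ^ 30) (q ^ 30) / qPochInf (q ^ 2) (q ^ 2))) ∧
    (∀ q : PowerSeries ℤ, q = PowerSeries.X →
      HasSum
        (fun p : ℕ × ℕ =>
          q ^ (2 * p.1 ^ 2 + 3 * p.2 ^ 2 + 4 * p.1 * p.2) *
            PowerSeries.invOfUnit
              (qPoch (-q) q (2 * p.1 + 2 * p.2) * qPoch q (q ^ 2) p.2 * qPoch q q p.2 *
                qPoch (q ^ 2) (q ^ 2) p.1) 1)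
        (qPochInf₃ (q ^ 14) (q ^ 16) (q ^ 30) (q ^ 30) *
          PowerSeries.invOfUnit (qPochInf (q ^ 2) (q ^ 2)) 1) ∧
      HasSum
        (fun p : ℕ × ℕ =>
          q ^ (2 * p.1 ^ 2 + 3 * p.2 ^ 2 + 4 * p.1 * p.2 + 4 * p.1 + 6 * p.2) *
            PowerSeries.invOfUnit
              (qPoch (-q) q (2 * p.1 + 2 * p.2 + 2) * qPoch q (q ^ 2) (p.2 + 1) * qPoch q q p.2 *
                qPoch (q ^ 2) (q ^ 2) p.1) 1)
        (qPochInf₃ (q ^ 2) (q ^ 28) (q ^ 30) (q ^ 30) *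
          PowerSeries.invOfUnit (qPochInf (q ^ 2) (q ^ 2)) 1)) := by
  refine ⟨fun q hq => ⟨?_, ?_⟩, ?_⟩
  · have h := hasSum_modThirty_first hq
    simpa only [Ring.inverse_eq_inv', ← div_eq_mul_inv] using h
  · have h := hasSum_modThirty_second hq
    simpa only [Ring.inverse_eq_inv', ← div_eq_mul_inv] using h
  · rintro q rfl
    -- The identity map is continuous from the X-adic to the coefficientwise topology, so it
    -- preserves sums.
    have h1 := (hasSum_modThirty_first AdicPowerSeries.norm_X_lt_one).map
      AdicPowerSeries.toPowerSeries AdicPowerSeries.continuous_toPowerSeries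
    have h2 := (hasSum_modThirty_second AdicPowerSeries.norm_X_lt_one).map
      AdicPowerSeries.toPowerSeries AdicPowerSeries.continuous_toPowerSeries
    simp only [Function.comp_def, AdicPowerSeries.toPowerSeries_pow_mul_inverse,
      AdicPowerSeries.toPowerSeries_qPochInf₃_mul_inverse _ _ _ (by norm_num : 0 < 30) two_pos]
      at h1 h2
    exact ⟨h1, h2⟩
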